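/- A finite Markov decision process (MDP) $\mathcal M$ consists of a finite directed graph $(V,E)$ without deadlocks, a partition of $V$ into player vertices and probabilistic vertices, for every probabilistic vertex $v$ a probability distribution whose support is exactly the set of out-neighbours of $v$, and a payoff $w(e)\in\mathbb Q$ for every edge $e\in E$. A play is an infinite path. A (deterministic) strategy maps every finite path ending in a player vertex to an out-neighbour of that vertex. A strategy $\sigma$ and an initial vertex $v$ determine the set of outcomes (the plays from $v$ that follow $\sigma$ at all player vertices, with arbitrary moves at probabilistic vertices) and a probability measure $\Pr^\sigma_{\mathcal M,v}$ on plays. For an integer $\ell\ge 1$ and $\lambda\in\mathbb Q$, a play $v_0v_1v_2\cdots$ satisfies $\mathrm{FWMP}(\ell,\lambda)$ if there is $k\ge 0$ such that for every $i\ge k$ there is $j\in\{1,\dots,\ell\}$ with $\frac1j\sum_{m=0}^{j-1}w(v_{i+m},v_{i+m+1})\ge\lambda$. The winning region for sure-$O$ (respectively almost-sure-$O$) is the set of vertices $v$ for which there is a strategy $\sigma$ all of whose outcomes from $v$ lie in $O$ (respectively with $\Pr^\sigma_{\mathcal M,v}(O)=1$). The winning region for sure-$A$-limit-sure-$B$ is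 the set of vertices $v$ such that for every $0<\varepsilon<1$ there is a single strategy $\sigma_\varepsilon$ all of whose outcomes from $v$ lie in $A$ and with $\Pr^{\sigma_\varepsilon}_{\mathcal M,v}(B)\ge 1-\varepsilon$. **Theorem.** Let $\mathcal M$ be a finite MDP, $\ell\ge 1$, and $\alpha,\beta\in\mathbb Q$. Let $W_\alpha$ be the winning region for sure-$\mathrm{FWMP}(\ell,\alpha)$ in $\mathcal M$. It induces a subMDP $\mathcal M{\restriction}W_\alpha$ (every vertex of $W_\alpha$ has an out-neighbour in $W_\alpha$, and every probabilistic vertex of $W_\alpha$ has all its out-neighbours in $W_\alpha$), obtained by restricting $\mathcal M$ to $W_\alpha$. The winning region for almost-sure-$\mathrm{FWMP}(\ell,\beta)$ in $\mathcal M{\restriction}W_\alpha$ (the set returned by the procedure that first computes $W_\alpha$ and then the almost-sure winning region in $\mathcal M{\restriction}W_\alpha$) equals the winning region for sure-$\mathrm{FWMP}(\ell,\alpha)$-limit-sure-$\mathrm{FWMP}(\ell,\beta)$ in $\mathcal M$. -/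

import Mathlib

/-- A Markov decision process with vertex set `V` (finiteness of `V` is assumed where it is used).
Vertices in `main` belong to the player; the vertices outside `main` are probabilistic, and each of
them carries a probability distribution whose support is exactly its set of out-neighbours.
Only the values of `payoff` on edges are ever used. -/
structure MDP (V : Type*) where
  Edge : V → V → Prop
  exists_edge : ∀ v, ∃ u, Edge v u
  main : Set V
  prob : ∀ v, v ∉ main → PMF V
  support_prob : ∀ v (hv : v ∉ main), (prob v hv).support = {u | Edge v u}
  payoff : V → V → ℚ

namespace MDP

variable {V : Type*} (M : MDP V)

/-- The infinite plays of `M`. -/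
def plays : Set (ℕ → V) := {ρ | ∀ i, M.Edge (ρ i) (ρ (i + 1))}

/-- The suffix `ρ i, ρ (i + 1), …` of a sequence of vertices. -/
def suffix (ρ : ℕ → V) (i : ℕ) : ℕ → V := fun n => ρ (i + n)

/-! ### Window mean-payoff objectives -/

/-- Good window: the `thr`-window opened at position `0` closes within `ℓ` steps. -/
def GW (ℓ : ℕ) (thr : ℚ) : Set (ℕ → V) :=
  {ρ | ρ ∈ M.plays ∧ ∃ j : ℕ, 1 ≤ j ∧ j ≤ ℓ ∧
    thr ≤ (1 / (j : ℚ)) * ∑ k ∈ Finset.range j, M.payoff (ρ k) (ρ (k + 1))}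

/-- Direct fixed window mean-payoff: every `thr`-window closes within `ℓ` steps. -/
def DirFWMP (ℓ : ℕ) (thr : ℚ) : Set (ℕ → V) :=
  {ρ | ρ ∈ M.plays ∧ ∀ i, suffix ρ i ∈ M.GW ℓ thr}

/-- Fixed window mean-payoff: some suffix of the play satisfies `DirFWMP`. -/
def FWMP (ℓ : ℕ) (thr : ℚ) : Set (ℕ → V) :=
  {ρ | ρ ∈ M.plays ∧ ∃ k, suffix ρ k ∈ M.DirFWMP ℓ thr}

/-! ### Strategies, outcomes, and the induced probability measure -/

/-- A deterministic strategy: a finite history `v₀ … vₙ` (a function on `{0, …, n}`) that ends in a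
player vertex is mapped to an out-neighbour of `vₙ`.  The values on histories that end in a
probabilistic vertex are never used. -/
structure Strategy where
  act : (n : ℕ) → (Finset.Iic n → V) → V
  edge_act : ∀ (n : ℕ) (h : Finset.Iic n → V), h ⟨n, Finset.mem_Iic.2 le_rfl⟩ ∈ M.main →
    M.Edge (h ⟨n, Finset.mem_Iic.2 le_rfl⟩) (act n h)

/-- The outcomes of the strategy `σ` from the vertex `v`. -/
def outcomes (σ : M.Strategy) (v : V) : Set (ℕ → V) :=
  {ρ | ρ ∈ M.plays ∧ ρ 0 = v ∧
    ∀ j, ρ j ∈ M.main → ρ (j + 1) = σ.act j (fun i : Finset.Iic j => ρ i)}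

open Classical in
/-- The distribution of the next vertex after the history `h` under the strategy `σ`. -/
noncomputable def stepPMF (σ : M.Strategy) (n : ℕ) (h : Finset.Iic n → V) : PMF V :=
  if hv : h ⟨n, Finset.mem_Iic.2 le_rfl⟩ ∈ M.main then PMF.pure (σ.act n h)
  else M.prob (h ⟨n, Finset.mem_Iic.2 le_rfl⟩) hv

section Law

variable [Finite V] [MeasurableSpace V] [DiscreteMeasurableSpace V]

/-- The transition kernel from histories of length `n` to the next vertex. -/
noncomputable def stepKernel (σ : M.Strategy) (n : ℕ) :
    ProbabilityTheory.Kernel (Finset.Iic n → V) V where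
  toFun h := (M.stepPMF σ n h).toMeasure
  measurable' := .of_discrete

instance (σ : M.Strategy) (n : ℕ) : ProbabilityTheory.IsMarkovKernel (M.stepKernel σ n) :=
  ⟨fun h => PMF.toMeasure.isProbabilityMeasure (M.stepPMF σ n h)⟩

/-- The probability measure on infinite sequences of vertices that is obtained by fixing the
strategy `σ` and the initial vertex `v` (Ionescu-Tulcea). -/
noncomputable def law (σ : M.Strategy) (v : V) : MeasureTheory.Measure (ℕ → V) :=
  ProbabilityTheory.Kernel.traj (X := fun _ => V) (M.stepKernel σ) 0 (fun _ => v)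

end Law

/-! ### Winning regions -/

/-- The winning region for sure-`O`. -/
def sureRegion (O : Set (ℕ → V)) : Set V :=
  {v | ∃ σ : M.Strategy, M.outcomes σ v ⊆ O}

/-- The winning region for almost-sure-`O`. -/
def almostSureRegion [Finite V] [MeasurableSpace V] [DiscreteMeasurableSpace V]
    (O : Set (ℕ → V)) : Set V :=
  {v | ∃ σ : M.Strategy, M.law σ v O = 1}

/-- The winning region for sure-`A`-limit-sure-`B`: for every `0 < ε < 1` one strategy ensures `A`
on all its outcomes and ensures `B` with probability at least `1 - ε`. -/
def sureLimitSureRegion [Finite V] [MeasurableSpace V] [DiscreteMeasurableSpace V]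
    (A B : Set (ℕ → V)) : Set V :=
  {v | ∀ ε : ℝ, 0 < ε → ε < 1 → ∃ σ : M.Strategy,
    M.outcomes σ v ⊆ A ∧ ENNReal.ofReal (1 - ε) ≤ M.law σ v B}

/-! ### Induced subMDPs -/

/-- `W` induces a subMDP of `M`. -/
def InducesSubMDP (W : Set V) : Prop :=
  (∀ v ∈ W, ∃ u ∈ W, M.Edge v u) ∧ ∀ v ∈ W, v ∉ M.main → ∀ u, M.Edge v u → u ∈ W

/-- The subMDP of `M` induced by `W`, on the vertex set `W`. -/
noncomputable def subMDP (W : Set V) (hW : M.InducesSubMDP W) : MDP W where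
  Edge v u := M.Edge v u
  exists_edge v := by
    obtain ⟨u, hu, h⟩ := hW.1 v v.2
    exact ⟨⟨u, hu⟩, h⟩
  main := {v | (v : V) ∈ M.main}
  prob v hv := ⟨fun u => M.prob v hv u, by
    have hs : Function.support (M.prob v hv) ⊆ W := by
      intro u hu
      have hu' : u ∈ (M.prob v hv).support := hu
      rw [M.support_prob] at hu'
      exact hW.2 v v.2 hv u hu'
    exact (hasSum_subtype_iff_of_support_subset hs).2 (M.prob v hv).2⟩
  support_prob v hv := by
    ext u
    have h : (u : V) ∈ (M.prob v hv).support ↔ M.Edge v u := by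
      rw [M.support_prob]; rfl
    exact h
  payoff v u := M.payoff v u

variable {M}

theorem suffix_mem_plays {ρ : ℕ → V} (h : ρ ∈ M.plays) (i : ℕ) : suffix ρ i ∈ M.plays :=
  fun n => h (i + n)

theorem suffix_suffix (ρ : ℕ → V) (i j : ℕ) : suffix (suffix ρ i) j = suffix ρ (i + j) := by
  funext n
  simp [suffix, Nat.add_assoc]

theorem suffix_mem_FWMP {ℓ : ℕ} {thr : ℚ} {ρ : ℕ → V} (h : ρ ∈ M.FWMP ℓ thr) (j : ℕ) :
    suffix ρ j ∈ M.FWMP ℓ thr := by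
  obtain ⟨hp, k, hk, hk'⟩ := h
  refine ⟨suffix_mem_plays hp j, k, ?_, fun i => ?_⟩
  · exact suffix_mem_plays (suffix_mem_plays hp j) k
  · have := hk' (j + i)
    rw [suffix_suffix] at this
    rw [suffix_suffix, suffix_suffix, show j + (k + i) = k + (j + i) by omega]
    exact this

/-- The history `v, h 0, …, h n`. -/
def consHistory (v : V) {n : ℕ} (h : Finset.Iic n → V) : Finset.Iic (n + 1) → V :=
  fun i => if hi : i.1 = 0 then v
    else h ⟨i.1 - 1, by have := Finset.mem_Iic.1 i.2; exact Finset.mem_Iic.2 (by omega)⟩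

/-- The strategy that plays as `σ` does after one step from `v`. -/
noncomputable def Strategy.shift (σ : M.Strategy) (v : V) : M.Strategy where
  act n h := σ.act (n + 1) (consHistory v h)
  edge_act n h hn := by
    have key : consHistory v h ⟨n + 1, Finset.mem_Iic.2 le_rfl⟩ =
        h ⟨n, Finset.mem_Iic.2 le_rfl⟩ := by
      simp [consHistory]
    have := σ.edge_act (n + 1) (consHistory v h) (by rw [key]; exact hn)
    rwa [key] at this

theorem mem_sureRegion_of_step {O : Set (ℕ → V)}
    (hO : ∀ ρ ∈ O, ∀ j, suffix ρ j ∈ O) {σ : M.Strategy} {v u : V}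
    (hσ : M.outcomes σ v ⊆ O) (huv : M.Edge v u)
    (hu : v ∈ M.main → u = σ.act 0 (fun _ => v)) : u ∈ M.sureRegion O := by
  refine ⟨σ.shift v, fun ρ hρ => ?_⟩
  obtain ⟨hp, h0, hact⟩ := hρ
  let ρ' : ℕ → V := fun n => Nat.casesOn n v ρ
  have hsuf : suffix ρ' 1 = ρ := by
    funext n
    simp only [suffix, ρ', Nat.add_comm 1 n]
  rw [← hsuf]
  refine hO _ (hσ ⟨?_, rfl, ?_⟩) 1
  · rintro (_ | i)
    · change M.Edge v (ρ 0)
      rwa [h0]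
    · exact hp i
  · rintro (_ | j) hj
    · change ρ 0 = _
      rw [h0, hu hj]
      congr 1
      funext ⟨i, hi⟩
      have hi0 : i = 0 := by simpa using hi
      subst hi0
      rfl
    · change ρ (j + 1) = _
      rw [hact j hj]
      change σ.act (j + 1) _ = _
      congr 1
      funext ⟨i, hi⟩
      cases i with
      | zero => rfl
      | succ i => rfl

/-- The winning region for sure-`O` induces a subMDP when `O` is closed under suffixes. -/
theorem inducesSubMDP_sureRegion {O : Set (ℕ → V)}
    (hO : ∀ ρ ∈ O, ∀ j, suffix ρ j ∈ O) : M.InducesSubMDP (M.sureRegion O) := by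
  refine ⟨?_, ?_⟩
  · rintro v ⟨σ, hσ⟩
    by_cases hv : v ∈ M.main
    · have he := σ.edge_act 0 (fun _ => v) hv
      exact ⟨_, mem_sureRegion_of_step hO hσ he (fun _ => rfl), he⟩
    · obtain ⟨u, hu⟩ := M.exists_edge v
      exact ⟨u, mem_sureRegion_of_step hO hσ hu (fun h => absurd h hv), hu⟩
  · rintro v ⟨σ, hσ⟩ hv u hu
    exact mem_sureRegion_of_step hO hσ hu (fun h => absurd h hv)

variable (M)

/-- The subMDP of `M` induced by the winning region for sure-`FWMP ℓ α`. -/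
noncomputable def sureFWMPSubMDP (ℓ : ℕ) (α : ℚ) : MDP (M.sureRegion (M.FWMP ℓ α)) :=
  M.subMDP (M.sureRegion (M.FWMP ℓ α)) (inducesSubMDP_sureRegion fun _ h j => suffix_mem_FWMP h j)

/-- The set returned by the two-step procedure: first compute the winning region for
sure-`FWMP ℓ α` in `M`, then return the winning region for almost-sure-`FWMP ℓ β` in the subMDP
that it induces (as a set of vertices of `M`). -/
noncomputable def slsFWMP [Finite V] [MeasurableSpace V] [DiscreteMeasurableSpace V]
    (ℓ : ℕ) (α β : ℚ) : Set V :=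
  Subtype.val '' (M.sureFWMPSubMDP ℓ α).almostSureRegion ((M.sureFWMPSubMDP ℓ α).FWMP ℓ β)

end MDP

/-! Write `FWMP ℓ β` as the increasing union over `k` of the sets `FWMPFrom ℓ β k`. Each of these is
closed: a play lies in it as soon as all its finite histories extend to members. The objective is
also unaffected by adding or removing finite prefixes.

From almost sure to sure-limit-sure (`slsFWMP_subset`), suppose `α ≤ β`. By continuity of measure
some closed set `FWMPFrom ℓ β k` already has probability above `1 - ε`. Play the almost-sure
strategy until the history cannot be continued inside that set, then switch to a sure strategy for
`α`, which exists because the play is still in the sure region (`fallback`). If no switch occurs,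
the play satisfies `β`, hence `α`; and switching does not decrease the probability of the closed
set. If `β < α`, sure `α` implies sure `β`.

Conversely (`sureLimitSureRegion_subset`), a strategy that surely wins `α` never leaves the sure
region, so it lives in the subMDP and `β` is limit-sure there. It remains to see that limit-sure
implies almost-sure for such objectives (`exists_law_eq_one_of_limitSure`). Follow a good strategy
aimed at a closed set, monitor the conditional probability of missing that set, and restart when
this risk is too high. A supermartingale shows that restarts are almost surely finite in number;
after the last one the risk stays below 1, so by closedness the play never leaves the target. -/

open MeasureTheory ProbabilityTheory
open scoped ENNReal

namespace MDP

/-! ### Events and functions decided at a finite time -/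

section Histories

variable {V : Type*}

/-- The history `ρ 0, …, ρ n`. -/
def hist (n : ℕ) (ρ : ℕ → V) : Finset.Iic n → V := fun i => ρ i

/-- A path with the given history. -/
def extend {n : ℕ} (h : Finset.Iic n → V) : ℕ → V :=
  fun i => h ⟨min i n, Finset.mem_Iic.2 (min_le_right _ _)⟩

/-- The path `ρ` with the vertex at position `n + 1` replaced by `u`. -/
def snoc (n : ℕ) (ρ : ℕ → V) (u : V) : ℕ → V := Function.update ρ (n + 1) u

@[simp] theorem snoc_succ (n : ℕ) (ρ : ℕ → V) (u : V) : snoc n ρ u (n + 1) = u := by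
  simp [snoc]

theorem snoc_of_le {n i : ℕ} (h : i ≤ n) (ρ : ℕ → V) (u : V) : snoc n ρ u i = ρ i := by
  rw [snoc, Function.update_of_ne (by omega)]

theorem hist_congr {n : ℕ} {ρ ρ' : ℕ → V} (h : ∀ i ≤ n, ρ i = ρ' i) : hist n ρ = hist n ρ' := by
  funext ⟨i, hi⟩
  exact h i (Finset.mem_Iic.1 hi)

theorem extend_hist {n i : ℕ} (h : i ≤ n) (ρ : ℕ → V) : extend (hist n ρ) i = ρ i := by
  simp [extend, hist, min_eq_left h]

theorem extend_apply_self {n : ℕ} (h : Finset.Iic n → V) :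
    extend h n = h ⟨n, Finset.mem_Iic.2 le_rfl⟩ := by
  simp [extend]

/-- `f` only depends on the history up to time `n`. -/
def LocalAt {β : Type*} (n : ℕ) (f : (ℕ → V) → β) : Prop :=
  ∀ ρ ρ' : ℕ → V, (∀ i ≤ n, ρ i = ρ' i) → f ρ = f ρ'

theorem LocalAt.mono {β : Type*} {n m : ℕ} {f : (ℕ → V) → β} (hf : LocalAt n f) (h : n ≤ m) :
    LocalAt m f := fun ρ ρ' hρ => hf ρ ρ' fun i hi => hρ i (hi.trans h)

theorem LocalAt.snoc {β : Type*} {n : ℕ} {f : (ℕ → V) → β} (hf : LocalAt n f) (ρ : ℕ → V) (u : V) :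
    f (snoc n ρ u) = f ρ := hf _ _ fun _ hi => snoc_of_le hi ρ u

/-- Cylinders form a generating π-system, and each is decided at some finite time, which may be
taken to be at least `m`. -/
theorem ext_of_localAt [MeasurableSpace V] {μ ν : Measure (ℕ → V)}
    [IsFiniteMeasure μ] [IsFiniteMeasure ν] (m : ℕ) (h : ∀ n, m ≤ n → ∀ A : Set (ℕ → V), LocalAt n (· ∈ A) → μ A = ν A) : μ = ν := by
  refine ext_of_generate_finite (measurableCylinders (fun _ : ℕ => V))
    generateFrom_measurableCylinders.symm isPiSystem_measurableCylinders ?_ ?_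
  · intro A hA
    obtain ⟨s, S, -, rfl⟩ := (mem_measurableCylinders A).1 hA
    refine h (max m (s.sup id)) (le_max_left _ _) _ fun ρ ρ' hρ => ?_
    have : (s : Set ℕ).domRestrict ρ = (s : Set ℕ).domRestrict ρ' := by
      funext ⟨i, hi⟩
      exact hρ i (le_max_of_le_right (Finset.le_sup (f := id) hi))
    exact congrArg (· ∈ S) this
  · exact h m le_rfl _ fun _ _ _ => by simp

variable [Finite V] [MeasurableSpace V] [DiscreteMeasurableSpace V]

theorem LocalAt.measurable {β : Type*} [MeasurableSpace β] {n : ℕ} {f : (ℕ → V) → β}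
    (hf : LocalAt n f) : Measurable f := by
  have h : f = (fun h : Finset.Iic n → V => f (extend h)) ∘ hist n := by
    funext ρ
    exact hf _ _ fun i hi => (extend_hist hi ρ).symm
  rw [h]
  exact Measurable.of_discrete.comp (measurable_pi_lambda _ fun i => measurable_pi_apply _)

theorem LocalAt.measurableSet {n : ℕ} {A : Set (ℕ → V)} (hA : LocalAt n (· ∈ A)) :
    MeasurableSet A := measurableSet_setOfPred.2 hA.measurable

end Histories

/-! ### One-step analysis of the law of a strategy -/

variable {V : Type*} {M : MDP V}

/-- The probability of moving to `u` after the history of `ρ` up to time `n`. -/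
noncomputable def step (σ : M.Strategy) (n : ℕ) (ρ : ℕ → V) (u : V) : ℝ≥0∞ :=
  M.stepPMF σ n (hist n ρ) u

theorem tsum_step (σ : M.Strategy) (n : ℕ) (ρ : ℕ → V) : ∑' u, step σ n ρ u = 1 :=
  (M.stepPMF σ n (hist n ρ)).tsum_coe

theorem step_main (σ : M.Strategy) {n : ℕ} {ρ : ℕ → V} (h : ρ n ∈ M.main) :
    step σ n ρ = fun u => PMF.pure (σ.act n (hist n ρ)) u := by
  funext u
  rw [step, stepPMF, dif_pos (show hist n ρ ⟨n, _⟩ ∈ M.main from h)]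

theorem step_not_main (σ : M.Strategy) {n : ℕ} {ρ : ℕ → V} (h : ρ n ∉ M.main) :
    step σ n ρ = fun u => M.prob (ρ n) h u := by
  funext u
  rw [step, stepPMF, dif_neg (show hist n ρ ⟨n, _⟩ ∉ M.main from h)]
  rfl

/-- `ρ` follows `σ` from position `n` to position `n + 1`. -/
def Follows (σ : M.Strategy) (n : ℕ) (ρ : ℕ → V) : Prop :=
  M.Edge (ρ n) (ρ (n + 1)) ∧ (ρ n ∈ M.main → ρ (n + 1) = σ.act n (hist n ρ))

theorem localAt_follows (σ : M.Strategy) (n : ℕ) : LocalAt (n + 1) (Follows σ n) := by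
  intro ρ ρ' h
  rw [Follows, Follows, h n (by omega), h (n + 1) le_rfl,
    hist_congr fun i hi => h i (Nat.le_succ_of_le hi)]

theorem follows_of_step_ne_zero {σ : M.Strategy} {n : ℕ} {ρ : ℕ → V} {u : V}
    (h : step σ n ρ u ≠ 0) : Follows σ n (snoc n ρ u) := by
  have hh : hist n (snoc n ρ u) = hist n ρ := hist_congr fun i hi => snoc_of_le hi ρ u
  rw [Follows, snoc_succ, snoc_of_le le_rfl, hh]
  by_cases hm : ρ n ∈ M.main
  · rw [step_main σ hm] at h
    have hu : u = σ.act n (hist n ρ) := by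
      by_contra hne
      exact h (by simp [PMF.pure_apply, hne])
    refine ⟨?_, fun _ => hu⟩
    rw [hu]
    exact σ.edge_act n (hist n ρ) hm
  · rw [step_not_main σ hm] at h
    refine ⟨?_, fun h' => absurd h' hm⟩
    have : u ∈ (M.prob (ρ n) hm).support := h
    rwa [M.support_prob] at this

theorem mem_outcomes_iff {σ : M.Strategy} {v : V} {ρ : ℕ → V} :
    ρ ∈ M.outcomes σ v ↔ ρ 0 = v ∧ ∀ n, Follows σ n ρ := by
  constructor
  · rintro ⟨hp, h0, h⟩
    exact ⟨h0, fun n => ⟨hp n, h n⟩⟩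
  · rintro ⟨h0, h⟩
    exact ⟨fun n => (h n).1, h0, fun n => (h n).2⟩

/-- The strategy that picks `f n ρ` after the history of `ρ` up to time `n`. -/
def Strategy.ofFun (f : ℕ → (ℕ → V) → V)
    (hf : ∀ n ρ, ρ n ∈ M.main → M.Edge (ρ n) (f n ρ)) : M.Strategy where
  act n h := f n (extend h)
  edge_act n h hn := by
    rw [← extend_apply_self h] at hn ⊢
    exact hf n _ hn

theorem Strategy.ofFun_act {f : ℕ → (ℕ → V) → V}
    (hf : ∀ n ρ, ρ n ∈ M.main → M.Edge (ρ n) (f n ρ)) {n : ℕ} (h : LocalAt n (f n)) (ρ : ℕ → V) :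
    (Strategy.ofFun f hf).act n (hist n ρ) = f n ρ :=
  h _ _ fun _ hi => extend_hist hi ρ

theorem exists_strategy (M : MDP V) : Nonempty M.Strategy := by
  choose f hf using M.exists_edge
  exact ⟨Strategy.ofFun (M := M) (fun n ρ => f (ρ n)) fun n ρ _ => hf _⟩

variable [Finite V] [MeasurableSpace V] [DiscreteMeasurableSpace V]

/-- The law of the play that continues the history of `ρ` up to time `n`. -/
noncomputable def lawFrom (σ : M.Strategy) (n : ℕ) (ρ : ℕ → V) : Measure (ℕ → V) :=
  Kernel.traj (X := fun _ => V) (M.stepKernel σ) n (hist n ρ)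

instance (σ : M.Strategy) (n : ℕ) (ρ : ℕ → V) : IsProbabilityMeasure (lawFrom σ n ρ) := by
  unfold lawFrom; infer_instance

theorem law_eq_lawFrom (σ : M.Strategy) (ρ : ℕ → V) : M.law σ (ρ 0) = lawFrom σ 0 ρ := by
  unfold law lawFrom
  congr 1
  funext ⟨i, hi⟩
  have : i = 0 := by simpa using hi
  subst this
  rfl

instance (σ : M.Strategy) (v : V) : IsProbabilityMeasure (M.law σ v) := by
  unfold law; infer_instance

theorem lawFrom_congr (σ : M.Strategy) {n : ℕ} {ρ ρ' : ℕ → V} (h : ∀ i ≤ n, ρ i = ρ' i) :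
    lawFrom σ n ρ = lawFrom σ n ρ' := by
  rw [lawFrom, hist_congr h, lawFrom]

theorem ae_lawFrom_agree (σ : M.Strategy) (n : ℕ) (ρ : ℕ → V) :
    ∀ᵐ ρ' ∂lawFrom σ n ρ, ∀ i ≤ n, ρ' i = ρ i := by
  have h := Kernel.traj_map_frestrictLe_apply (X := fun _ => V) (κ := M.stepKernel σ) n n (hist n ρ)
  rw [Kernel.partialTraj_self, Kernel.id_apply] at h
  have h2 : ∀ᵐ y ∂((Kernel.traj (X := fun _ => V) (M.stepKernel σ) n (hist n ρ)).map
      (Preorder.frestrictLe n)), y = hist n ρ := by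
    rw [h, ae_dirac_iff (measurableSet_eq)]
  have h3 := ae_of_ae_map (Preorder.measurable_frestrictLe n).aemeasurable h2
  filter_upwards [h3] with ρ' hρ' i hi
  exact congrFun hρ' ⟨i, Finset.mem_Iic.2 hi⟩

/-- Conditioning on the next vertex. Later arguments about probabilities rest on this equation
instead of the Ionescu-Tulcea construction. -/
theorem lintegral_lawFrom (σ : M.Strategy) (n : ℕ) (ρ : ℕ → V) {f : (ℕ → V) → ℝ≥0∞}
    (hf : Measurable f) :
    ∫⁻ x, f x ∂lawFrom σ n ρ =
      ∑' u, step σ n ρ u * ∫⁻ x, f x ∂lawFrom σ (n + 1) (snoc n ρ u) := by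
  have hcount : ∀ g : V → ℝ≥0∞, ∫⁻ u, g u ∂(M.stepKernel σ n (hist n ρ)) =
      ∑' u, step σ n ρ u * g u := by
    intro g
    rw [lintegral_countable']
    refine tsum_congr fun u => ?_
    rw [mul_comm]
    congr 1
    exact PMF.toMeasure_apply_singleton _ _ (measurableSet_singleton u)
  rw [lawFrom, ← Kernel.traj_comp_partialTraj (X := fun _ => V) (κ := M.stepKernel σ) (Nat.le_add_right n 1),
    Kernel.lintegral_comp _ _ _ hf, Kernel.partialTraj_succ_self,
    Kernel.lintegral_map _ (measurable_IicProdIoc (X := fun _ : ℕ => V)) _ (by fun_prop),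
    Kernel.lintegral_id_prod (by fun_prop), Kernel.lintegral_map _ (by fun_prop) _ (by fun_prop), hcount]
  refine tsum_congr fun u => ?_
  congr 2
  rw [lawFrom]
  congr 1
  funext ⟨i, hi⟩
  have hi' := Finset.mem_Iic.1 hi
  rcases Nat.le_succ_iff.1 hi' with h | h
  · simp [IicProdIoc_def, h, hist, snoc_of_le h]
  · subst h
    simp [IicProdIoc_def, hist, MeasurableEquiv.piSingleton]

theorem lawFrom_apply (σ : M.Strategy) (n : ℕ) (ρ : ℕ → V) {A : Set (ℕ → V)}
    (hA : MeasurableSet A) :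
    lawFrom σ n ρ A = ∑' u, step σ n ρ u * lawFrom σ (n + 1) (snoc n ρ u) A := by
  have := lintegral_lawFrom σ n ρ (measurable_one.indicator hA)
  simpa only [lintegral_indicator_one hA] using this

theorem lintegral_lawFrom_of_localAt (σ : M.Strategy) {n : ℕ} (ρ : ℕ → V) {f : (ℕ → V) → ℝ≥0∞}
    (hf : LocalAt n f) : ∫⁻ x, f x ∂lawFrom σ n ρ = f ρ := by
  have : ∀ᵐ x ∂lawFrom σ n ρ, f x = f ρ :=
    (ae_lawFrom_agree σ n ρ).mono fun x hx => hf _ _ hx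
  rw [lintegral_congr_ae this]
  simp

open Classical in
theorem lawFrom_apply_of_localAt (σ : M.Strategy) {n : ℕ} (ρ : ℕ → V) {A : Set (ℕ → V)}
    (hA : LocalAt n (· ∈ A)) : lawFrom σ n ρ A = if ρ ∈ A then 1 else 0 := by
  have h := lintegral_lawFrom_of_localAt σ (n := n) ρ (f := A.indicator 1) fun x y hxy => by
    simp only [Set.indicator, show (x ∈ A) = (y ∈ A) from hA x y hxy]; rfl
  rw [lintegral_indicator_one hA.measurableSet] at h
  rw [h]; rfl

/-- A function of the history that is superharmonic along an invariant does not increase in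
expectation. -/
theorem lintegral_lawFrom_le {σ : M.Strategy} {F : ℕ → (ℕ → V) → ℝ≥0∞}
    (hF : ∀ n, LocalAt n (F n)) {P : ℕ → (ℕ → V) → Prop}
    (hP : ∀ n ρ u, P n ρ → step σ n ρ u ≠ 0 → P (n + 1) (snoc n ρ u))
    (hle : ∀ n ρ, P n ρ → ∑' u, step σ n ρ u * F (n + 1) (snoc n ρ u) ≤ F n ρ)
    (k n : ℕ) (ρ : ℕ → V) (h : P n ρ) : ∫⁻ x, F (n + k) x ∂lawFrom σ n ρ ≤ F n ρ := by
  induction k generalizing n ρ with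
  | zero => exact (lintegral_lawFrom_of_localAt σ ρ (hF n)).le
  | succ k ih =>
    rw [lintegral_lawFrom σ n ρ (hF _).measurable]
    refine le_trans (ENNReal.tsum_le_tsum fun u => ?_) (hle n ρ h)
    by_cases hu : step σ n ρ u = 0
    · simp [hu]
    · gcongr
      have := ih (n + 1) (snoc n ρ u) (hP n ρ u h hu)
      rwa [show n + 1 + k = n + (k + 1) by omega] at this

/-- The indicator of the failure of `P` is superharmonic along `P` and starts at 0, so its
expectation stays 0. -/
theorem ae_lawFrom_invariant {σ : M.Strategy} {P : ℕ → (ℕ → V) → Prop}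
    (hl : ∀ n, LocalAt n (P n))
    (hP : ∀ n ρ u, P n ρ → step σ n ρ u ≠ 0 → P (n + 1) (snoc n ρ u))
    (ρ : ℕ → V) (h : P 0 ρ) : ∀ᵐ x ∂lawFrom σ 0 ρ, ∀ k, P k x := by
  classical
  rw [ae_all_iff]
  intro k
  have := lintegral_lawFrom_le (σ := σ) (F := fun n => {x | ¬ P n x}.indicator 1) (P := P)
    (fun n x y hxy => by simp [Set.indicator, hl n x y hxy]) hP
    (fun n ρ hρ => by
      refine le_of_eq_of_le (ENNReal.tsum_eq_zero.2 fun u => ?_) zero_le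
      by_cases hu : step σ n ρ u = 0
      · simp [hu]
      · simp [hP n ρ u hρ hu]) k 0 ρ h
  simp only [zero_add] at this
  rw [lintegral_indicator_one (LocalAt.measurableSet (n := k) fun x y hxy => by
    simp [hl k x y hxy])] at this
  rw [ae_iff]
  simpa [h] using this

theorem ae_law_outcomes (σ : M.Strategy) (v : V) : ∀ᵐ ρ ∂M.law σ v, ρ ∈ M.outcomes σ v := by
  have := ae_lawFrom_invariant (σ := σ) (P := fun n ρ => ρ 0 = v ∧ ∀ i < n, Follows σ i ρ)
    (fun n x y hxy => by
      have h1 : ∀ i < n, Follows σ i x = Follows σ i y := fun i hi =>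
        localAt_follows σ i x y fun j hj => hxy j (by omega)
      have h0 := hxy 0 (Nat.zero_le n)
      simp +contextual [h0, h1])
    (fun n ρ u h hu => by
      refine ⟨by rw [snoc_of_le (Nat.zero_le n), h.1], fun i hi => ?_⟩
      rcases Nat.lt_succ_iff_lt_or_eq.1 hi with h' | rfl
      · exact (((localAt_follows σ i).mono h').snoc ρ u).symm ▸ h.2 i h'
      · exact follows_of_step_ne_zero hu)
    (fun _ => v) ⟨rfl, fun i hi => absurd hi (Nat.not_lt_zero i)⟩
  rw [← law_eq_lawFrom] at this
  filter_upwards [this] with ρ hρ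
  exact mem_outcomes_iff.2 ⟨(hρ 0).1, fun n => (hρ (n + 1)).2 n (Nat.lt_succ_self n)⟩

/-! ### Transport of laws along maps of paths -/

section Coupling

variable {V V' : Type*} {M : MDP V} {M' : MDP V'}
  [Finite V] [MeasurableSpace V] [DiscreteMeasurableSpace V]
  [Finite V'] [MeasurableSpace V'] [DiscreteMeasurableSpace V']

/-- A map between paths that commutes with the steps of two strategies maps the law of one to the
law of the other. -/
theorem map_lawFrom {σ : M.Strategy} {σ' : M'.Strategy} (d : ℕ) {T : (ℕ → V') → ℕ → V}
    (hT : ∀ i, LocalAt (i + d) (fun ρ => T ρ i)) {P : ℕ → (ℕ → V') → Prop}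
    (hP : ∀ m ρ u, P m ρ → step σ' (m + d) ρ u ≠ 0 → P (m + 1) (snoc (m + d) ρ u))
    (hstep : ∀ m ρ, P m ρ → ∀ G : V → ℝ≥0∞,
      ∑' u, step σ' (m + d) ρ u * G (T (snoc (m + d) ρ u) (m + 1)) = ∑' u, step σ m (T ρ) u * G u)
    {m : ℕ} {ρ : ℕ → V'} (h : P m ρ) :
    (lawFrom σ' (m + d) ρ).map T = lawFrom σ m (T ρ) := by
  classical
  have hTm : Measurable T := measurable_pi_lambda _ fun i => (hT i).measurable
  have := Measure.isProbabilityMeasure_map (μ := lawFrom σ' (m + d) ρ) hTm.aemeasurable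
  have hloc : ∀ (n : ℕ) (A : Set (ℕ → V)), LocalAt n (· ∈ A) → LocalAt (n + d) (· ∈ T ⁻¹' A) :=
    fun n A hA x y hxy => hA _ _ fun i hi => hT i x y fun j hj => hxy j (by omega)
  -- Induction on the number `k` of moves left until the event is decided; the clock of `σ'` runs
  -- `d` ahead of that of `σ`.
  have key : ∀ k m ρ, P m ρ → ∀ A : Set (ℕ → V), LocalAt (m + k) (· ∈ A) →
      lawFrom σ' (m + d) ρ (T ⁻¹' A) = lawFrom σ m (T ρ) A := by
    intro k
    induction k with
    | zero =>
      intro m ρ _ A hA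
      rw [Nat.add_zero] at hA
      rw [lawFrom_apply_of_localAt _ _ hA, lawFrom_apply_of_localAt _ _ (hloc _ _ hA)]
      rfl
    | succ k ih =>
      intro m ρ hρ A hA
      rw [lawFrom_apply _ _ _ hA.measurableSet,
        lawFrom_apply _ _ _ (hloc _ _ hA).measurableSet, ← hstep m ρ hρ]
      refine tsum_congr fun u => ?_
      by_cases hu : step σ' (m + d) ρ u = 0
      · simp [hu]
      congr 1
      have h1 := ih (m + 1) _ (hP m ρ u hρ hu) A (by convert hA using 1; omega)
      rw [show m + 1 + d = m + d + 1 by omega] at h1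
      rw [h1]
      refine congrArg (· A) (lawFrom_congr σ fun i hi => ?_)
      rcases Nat.le_succ_iff.1 hi with hi | rfl
      · rw [snoc_of_le hi]
        exact ((hT i).mono (by omega)).snoc ρ u
      · rw [snoc_succ]
  refine ext_of_localAt m fun n hn A hA => ?_
  rw [Measure.map_apply hTm hA.measurableSet]
  exact key (n - m) m ρ h A (by rwa [Nat.add_sub_cancel' hn])

end Coupling

/-! ### Continuing a strategy after a finite history -/

section After

variable {V : Type*} {M : MDP V}

theorem step_congr {σ σ' : M.Strategy} {n n' : ℕ} {ρ ρ' : ℕ → V} (h : ρ n = ρ' n')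
    (hact : ρ n ∈ M.main → σ.act n (hist n ρ) = σ'.act n' (hist n' ρ')) :
    step σ n ρ = step σ' n' ρ' := by
  by_cases hm : ρ n ∈ M.main
  · rw [step_main σ hm, step_main σ' (h ▸ hm), hact hm]
  · rw [step_not_main σ hm, step_not_main σ' (h ▸ hm)]
    have : ∀ a b (_ : a = b) (ha : a ∉ M.main) (hb : b ∉ M.main), M.prob a ha = M.prob b hb := by
      rintro a _ rfl _ _; rfl
    rw [this _ _ h hm]

/-- The path that follows `ρ` before time `n` and `x` from time `n` on. -/
def splice (n : ℕ) (ρ x : ℕ → V) : ℕ → V := fun i => if i < n then ρ i else x (i - n)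

theorem splice_of_lt {n i : ℕ} (h : i < n) (ρ x : ℕ → V) : splice n ρ x i = ρ i := if_pos h

theorem splice_add (n i : ℕ) (ρ x : ℕ → V) : splice n ρ x (i + n) = x i := by
  simp [splice]

theorem suffix_splice (n : ℕ) (ρ x : ℕ → V) : suffix (splice n ρ x) n = x := by
  funext i
  rw [suffix, Nat.add_comm, splice_add]

theorem splice_suffix {n : ℕ} {ρ x : ℕ → V} (h : ∀ i < n, ρ i = x i) :
    splice n ρ (suffix x n) = x := by
  funext i
  by_cases hi : i < n
  · rw [splice_of_lt hi, h i hi]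
  · rw [splice, if_neg hi, suffix, Nat.add_sub_cancel' (not_lt.1 hi)]

theorem localAt_hist_splice (n m : ℕ) (ρ : ℕ → V) :
    LocalAt m (fun x => hist (m + n) (splice n ρ x)) := fun x y hxy =>
  hist_congr fun i hi => by
    by_cases h : i < n
    · rw [splice_of_lt h, splice_of_lt h]
    · rw [splice, splice, if_neg h, if_neg h, hxy _ (by omega)]

/-- The strategy that plays as `σ` does after the first `n` steps of `ρ`. -/
def Strategy.after (σ : M.Strategy) (n : ℕ) (ρ : ℕ → V) : M.Strategy :=
  .ofFun (fun m x => σ.act (m + n) (hist (m + n) (splice n ρ x))) fun m x hm => by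
    have := σ.edge_act (m + n) (hist (m + n) (splice n ρ x))
    simp only [hist, splice_add] at this
    exact this hm

theorem Strategy.after_act (σ : M.Strategy) (n m : ℕ) (ρ x : ℕ → V) :
    (σ.after n ρ).act m (hist m x) = σ.act (m + n) (hist (m + n) (splice n ρ x)) :=
  ofFun_act _ (fun x y hxy => congrArg (σ.act (m + n)) (localAt_hist_splice n m ρ x y hxy)) x

theorem Strategy.after_act_suffix (σ : M.Strategy) (n m : ℕ) {ρ x : ℕ → V}
    (h : ∀ i < n, ρ i = x i) :
    (σ.after n ρ).act m (hist m (suffix x n)) = σ.act (m + n) (hist (m + n) x) := by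
  rw [after_act, splice_suffix h]

theorem follows_splice {σ : M.Strategy} {n : ℕ} {ρ x : ℕ → V} (h0 : x 0 = ρ n)
    (hρ : ∀ i < n, Follows σ i ρ) (hx : ∀ i, Follows (σ.after n ρ) i x) (i : ℕ) :
    Follows σ i (splice n ρ x) := by
  by_cases hi : i < n
  · have : ∀ j ≤ i + 1, splice n ρ x j = ρ j := by
      intro j hj
      rcases (show j ≤ n by omega).lt_or_eq with h | rfl
      · exact splice_of_lt h _ _
      · have := splice_add j 0 ρ x
        rw [Nat.zero_add] at this
        rw [this, h0]
    exact (localAt_follows σ i _ _ this).symm ▸ hρ i hi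
  · obtain ⟨m, rfl⟩ := Nat.exists_eq_add_of_le' (not_lt.1 hi)
    have := hx m
    rw [Follows, Strategy.after_act] at this
    rw [Follows, splice_add, show m + n + 1 = m + 1 + n by omega, splice_add]
    exact this

theorem outcomes_after_subset {O : Set (ℕ → V)} (hO : ∀ ρ ∈ O, ∀ j, suffix ρ j ∈ O)
    {σ : M.Strategy} {n : ℕ} {ρ : ℕ → V} (hσ : M.outcomes σ (ρ 0) ⊆ O)
    (hρ : ∀ i < n, Follows σ i ρ) : M.outcomes (σ.after n ρ) (ρ n) ⊆ O := by
  intro x hx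
  obtain ⟨h0, hx⟩ := mem_outcomes_iff.1 hx
  rw [← suffix_splice n ρ x]
  refine hO _ (hσ (mem_outcomes_iff.2 ⟨?_, follows_splice h0 hρ hx⟩)) n
  rcases Nat.eq_zero_or_pos n with rfl | hn
  · simpa [splice] using h0
  · exact splice_of_lt hn _ _

theorem mem_sureRegion_of_follows {O : Set (ℕ → V)} (hO : ∀ ρ ∈ O, ∀ j, suffix ρ j ∈ O)
    {σ : M.Strategy} {n : ℕ} {ρ : ℕ → V} (hσ : M.outcomes σ (ρ 0) ⊆ O)
    (hρ : ∀ i < n, Follows σ i ρ) : ρ n ∈ M.sureRegion O :=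
  ⟨_, outcomes_after_subset hO hσ hρ⟩

variable [Finite V] [MeasurableSpace V] [DiscreteMeasurableSpace V]

/-- Markov property, as a coupling with clock offset `n`. The invariant is agreement with `ρ` before
time `n`, so that the past spliced in by `after` is the true one. -/
theorem map_suffix_lawFrom (σ : M.Strategy) (n : ℕ) (ρ : ℕ → V) :
    (lawFrom σ n ρ).map (fun x => suffix x n) = M.law (σ.after n ρ) (ρ n) := by
  have h := map_lawFrom (σ := σ.after n ρ) (σ' := σ) n (T := fun x => suffix x n)
    (fun i x y hxy => hxy (n + i) (by omega)) (P := fun m x => ∀ i < n, ρ i = x i)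
    (fun m x u hx _ i hi => by rw [hx i hi, snoc_of_le (by omega)])
    (fun m x hx G => by
      have : step σ (m + n) x = step (σ.after n ρ) m (suffix x n) :=
        step_congr (congrArg x (Nat.add_comm m n)) fun _ => (σ.after_act_suffix n m hx).symm
      rw [this]
      refine tsum_congr fun u => ?_
      rw [suffix, show n + (m + 1) = m + n + 1 by omega, snoc_succ]) (m := 0) (ρ := ρ)
    (fun _ _ => rfl)
  rw [Nat.zero_add, ← law_eq_lawFrom] at h
  exact h

end After

/-! ### Passing strategies between an MDP and a subMDP -/

section SubMDP

variable {V : Type*} {M : MDP V} {W : Set V} {hW : M.InducesSubMDP W}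

open Classical in
/-- The extension of a strategy of a subMDP. -/
noncomputable def Strategy.ofSub (v₀ : W) (σ : (M.subMDP W hW).Strategy) : M.Strategy :=
  .ofFun (fun n ρ => if ρ n ∈ W then
      (σ.act n (hist n fun i => if h : ρ i ∈ W then ⟨ρ i, h⟩ else v₀) : V)
      else (M.exists_edge (ρ n)).choose) fun n ρ hm => by
    split_ifs with h
    · have := σ.edge_act n (hist n fun i => if h : ρ i ∈ W then ⟨ρ i, h⟩ else v₀)
      simp only [hist, dif_pos h] at this
      exact this hm
    · exact (M.exists_edge (ρ n)).choose_spec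

open Classical in
theorem Strategy.ofSub_act (v₀ : W) (σ : (M.subMDP W hW).Strategy) (n : ℕ) (ρ : ℕ → W) :
    (σ.ofSub v₀).act n (hist n fun i => (ρ i : V)) = σ.act n (hist n ρ) := by
  rw [ofSub, ofFun_act]
  · simp
  · intro x y hxy
    have : hist n (fun i => if h : x i ∈ W then ⟨x i, h⟩ else v₀) =
        hist n (fun i => if h : y i ∈ W then ⟨y i, h⟩ else v₀) :=
      hist_congr fun i hi => by simp only [hxy i hi]
    simp only [hxy n le_rfl, this]

theorem Strategy.ofSub_act_mem (v₀ : W) (σ : (M.subMDP W hW).Strategy) {n : ℕ} {ρ : ℕ → V}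
    (h : ∀ i ≤ n, ρ i ∈ W) : (σ.ofSub v₀).act n (hist n ρ) ∈ W := by
  classical
  have : hist n ρ =
      hist n (fun i => ((if h : ρ i ∈ W then ⟨ρ i, h⟩ else v₀ : W) : V)) :=
    hist_congr fun i hi => by rw [dif_pos (h i hi)]
  rw [this, ofSub_act]
  exact Subtype.coe_prop _

open Classical in
/-- The action `a` if it stays in `W`, and some edge of the subMDP otherwise. -/
noncomputable def subAct (hW : M.InducesSubMDP W) (w : W) (a : V) : W :=
  if h : a ∈ W then ⟨a, h⟩ else ((M.subMDP W hW).exists_edge w).choose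

/-- The restriction of a strategy to a subMDP. -/
noncomputable def Strategy.toSub (hW : M.InducesSubMDP W) (σ : M.Strategy) :
    (M.subMDP W hW).Strategy :=
  .ofFun (fun n ρ => subAct hW (ρ n) (σ.act n (hist n fun i => (ρ i : V)))) fun n ρ hm => by
    unfold subAct
    split_ifs with h
    · exact σ.edge_act n (hist n fun i => (ρ i : V)) hm
    · exact ((M.subMDP W hW).exists_edge (ρ n)).choose_spec

theorem Strategy.toSub_act (σ : M.Strategy) {n : ℕ} {ρ : ℕ → W}
    (h : σ.act n (hist n fun i => (ρ i : V)) ∈ W) :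
    ((σ.toSub hW).act n (hist n ρ) : V) = σ.act n (hist n fun i => (ρ i : V)) := by
  rw [toSub, ofFun_act, subAct, dif_pos h]
  intro x y hxy
  have : hist n (fun i => (x i : V)) = hist n (fun i => (y i : V)) :=
    hist_congr fun i hi => by rw [hxy i hi]
  simp only [hxy n le_rfl, this]

variable [Finite V] [MeasurableSpace V] [DiscreteMeasurableSpace V]

/-- At probabilistic vertices the sums over `W` and over `V` agree because the support lies in `W`.
At player vertices the strategies need to agree only on histories that `σ'` can produce. -/
theorem map_val_law {σ : M.Strategy} {σ' : (M.subMDP W hW).Strategy} (v : W)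
    (hact : ∀ n (ρ : ℕ → W), ρ 0 = v → (∀ i < n, Follows σ' i ρ) → (ρ n : V) ∈ M.main →
      σ.act n (hist n fun i => (ρ i : V)) = σ'.act n (hist n ρ)) :
    ((M.subMDP W hW).law σ' v).map (fun ρ i => (ρ i : V)) = M.law σ v := by
  have h := map_lawFrom (σ := σ) (σ' := σ') 0 (T := fun ρ i => (ρ i : V))
    (fun i x y hxy => congrArg Subtype.val (hxy i le_rfl))
    (P := fun n ρ => ρ 0 = v ∧ ∀ i < n, Follows σ' i ρ)
    (fun n ρ u h hu => by
      refine ⟨by rw [snoc_of_le (Nat.zero_le _), h.1], fun i hi => ?_⟩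
      rcases Nat.lt_succ_iff_lt_or_eq.1 hi with h' | rfl
      · exact (((localAt_follows σ' i).mono h').snoc ρ u).symm ▸ h.2 i h'
      · exact follows_of_step_ne_zero hu)
    (fun n ρ hρ G => by
      simp only [Nat.add_zero, snoc_succ]
      by_cases hm : (ρ n : V) ∈ M.main
      · rw [step_main σ (ρ := fun i => (ρ i : V)) hm, step_main σ' (ρ := ρ) hm]
        simp only [PMF.pure_apply, ite_mul, one_mul, zero_mul, tsum_ite_eq]
        rw [hact n ρ hρ.1 hρ.2 hm]
      · rw [step_not_main σ (ρ := fun i => (ρ i : V)) hm, step_not_main σ' (ρ := ρ) hm]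
        refine tsum_subtype_eq_of_support_subset
          (f := fun u => M.prob (ρ n) hm u * G u) fun u hu => ?_
        have hu' : u ∈ (M.prob (ρ n) hm).support := left_ne_zero_of_mul hu
        rw [M.support_prob] at hu'
        exact hW.2 _ (ρ n).2 hm u hu') (m := 0) (ρ := fun _ => v)
    ⟨rfl, fun i hi => absurd hi (Nat.not_lt_zero i)⟩
  rw [Nat.add_zero, ← law_eq_lawFrom, ← law_eq_lawFrom] at h
  exact h

theorem map_val_law_ofSub (σ : (M.subMDP W hW).Strategy) (v : W) :
    ((M.subMDP W hW).law σ v).map (fun ρ i => (ρ i : V)) = M.law (σ.ofSub v) v :=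
  map_val_law v fun n ρ _ _ _ => σ.ofSub_act v n ρ

theorem map_val_law_toSub {σ : M.Strategy} {v : W}
    (h : ∀ n (ρ : ℕ → V), ρ 0 = v → (∀ i < n, Follows σ i ρ) → ρ n ∈ W) :
    ((M.subMDP W hW).law (σ.toSub hW) v).map (fun ρ i => (ρ i : V)) = M.law σ v := by
  -- Appending the chosen action gives a longer history that follows `σ`, so the hypothesis puts the
  -- action in `W` and `subAct` does not use its default.
  have key : ∀ n (ρ : ℕ → W), ρ 0 = v → (∀ i < n, Follows σ i fun i => (ρ i : V)) →
      (ρ n : V) ∈ M.main → σ.act n (hist n fun i => (ρ i : V)) ∈ W := by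
    intro n ρ h0 hρ hm
    have := h (n + 1) (snoc n (fun i => (ρ i : V)) (σ.act n (hist n fun i => (ρ i : V))))
      (by rw [snoc_of_le (Nat.zero_le _), h0]) fun i hi => by
        rcases Nat.lt_succ_iff_lt_or_eq.1 hi with h' | rfl
        · exact (((localAt_follows σ i).mono h').snoc _ _).symm ▸ hρ i h'
        · refine follows_of_step_ne_zero ?_
          rw [step_main σ (ρ := fun i => (ρ i : V)) hm]
          simp
    rwa [snoc_succ] at this
  have hfol : ∀ n (ρ : ℕ → W), ρ 0 = v → (∀ i < n, Follows (σ.toSub hW) i ρ) →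
      ∀ i < n, Follows σ i fun i => (ρ i : V) := by
    intro n ρ h0 hρ i
    induction i using Nat.strong_induction_on with
    | _ i ih =>
      intro hi
      refine ⟨(hρ i hi).1, fun hm => ?_⟩
      rw [← σ.toSub_act (hW := hW) (key i ρ h0 (fun j hj => ih j hj (hj.trans hi)) hm)]
      exact congrArg Subtype.val ((hρ i hi).2 hm)
  exact map_val_law v fun n ρ h0 hρ hm => (σ.toSub_act (key n ρ h0 (hfol n ρ h0 hρ) hm)).symm

end SubMDP

/-! ### Closed sets of paths -/

section Closed

variable {V : Type*}

theorem suffix_snoc {r n : ℕ} (h : r ≤ n) (ρ : ℕ → V) (u : V) :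
    suffix (snoc n ρ u) r = snoc (n - r) (suffix ρ r) u := by
  funext i
  by_cases hi : i = n - r + 1
  · subst hi
    rw [snoc_succ, suffix, show r + (n - r + 1) = n + 1 by omega, snoc_succ]
  · rw [suffix, snoc, snoc, Function.update_of_ne hi, Function.update_of_ne (by omega), suffix]

/-- The paths whose history up to time `n` is the history of some path in `C`. -/
def prefixes (C : Set (ℕ → V)) (n : ℕ) : Set (ℕ → V) := {ρ | ∃ x ∈ C, ∀ i ≤ n, x i = ρ i}

theorem localAt_prefixes (C : Set (ℕ → V)) (n : ℕ) : LocalAt n (· ∈ prefixes C n) := by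
  intro ρ ρ' h
  refine propext ⟨?_, ?_⟩
  · rintro ⟨x, hx, hi⟩
    exact ⟨x, hx, fun i hn => (hi i hn).trans (h i hn)⟩
  · rintro ⟨x, hx, hi⟩
    exact ⟨x, hx, fun i hn => (hi i hn).trans (h i hn).symm⟩

theorem subset_prefixes (C : Set (ℕ → V)) (n : ℕ) : C ⊆ prefixes C n :=
  fun ρ h => ⟨ρ, h, fun _ _ => rfl⟩

theorem antitone_prefixes (C : Set (ℕ → V)) : Antitone (prefixes C) := by
  rintro m n h ρ ⟨x, hx, hi⟩
  exact ⟨x, hx, fun i hm => hi i (hm.trans h)⟩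

/-- `C` contains every path all of whose histories are histories of paths in `C`. -/
def PrefixClosed (C : Set (ℕ → V)) : Prop := ∀ ρ, (∀ n, ρ ∈ prefixes C n) → ρ ∈ C

theorem PrefixClosed.iInter_prefixes {C : Set (ℕ → V)} (h : PrefixClosed C) :
    ⋂ n, prefixes C n = C :=
  Set.Subset.antisymm (fun ρ hρ => h ρ (Set.mem_iInter.1 hρ))
    (Set.subset_iInter fun n => subset_prefixes C n)

theorem PrefixClosed.measurableSet [Finite V] [MeasurableSpace V] [DiscreteMeasurableSpace V]
    {C : Set (ℕ → V)} (h : PrefixClosed C) : MeasurableSet C := by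
  rw [← h.iInter_prefixes]
  exact MeasurableSet.iInter fun n => (localAt_prefixes C n).measurableSet

end Closed

/-! ### Limit-sure implies almost-sure, by restarting -/

section Resets

variable {V : Type*} {M : MDP V} [Finite V] [MeasurableSpace V] [DiscreteMeasurableSpace V]
  (S : V → M.Strategy) (C : V → Set (ℕ → V)) (a : ℝ≥0∞)

/-- The probability of missing `C (ρ r)` after the history of `ρ` from time `r` to time `n`, when
the strategy `S (ρ r)` was started at time `r`. -/
noncomputable def risk (r n : ℕ) (ρ : ℕ → V) : ℝ≥0∞ :=
  lawFrom (S (ρ r)) (n - r) (suffix ρ r) (C (ρ r))ᶜ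

theorem localAt_risk {r n : ℕ} (h : r ≤ n) : LocalAt n (risk S C r n) := by
  intro x y hxy
  rw [risk, risk, hxy r h,
    lawFrom_congr _ (ρ := suffix x r) (ρ' := suffix y r) fun i hi => hxy (r + i) (by omega)]

open Classical in
/-- The last time up to `n` at which the strategy was restarted. A restart occurs as soon as the
risk reaches `4 * a`. -/
noncomputable def lastReset : ℕ → (ℕ → V) → ℕ
  | 0, _ => 0
  | n + 1, ρ => if 4 * a ≤ risk S C (lastReset n ρ) (n + 1) ρ then n + 1 else lastReset n ρ

open Classical in
/-- The number of restarts up to time `n`. -/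
noncomputable def numResets : ℕ → (ℕ → V) → ℕ
  | 0, _ => 0
  | n + 1, ρ => if 4 * a ≤ risk S C (lastReset S C a n ρ) (n + 1) ρ then numResets n ρ + 1
      else numResets n ρ

theorem lastReset_le (n : ℕ) (ρ : ℕ → V) : lastReset S C a n ρ ≤ n := by
  induction n with
  | zero => exact le_rfl
  | succ n ih => rw [lastReset]; split_ifs <;> omega

theorem localAt_lastReset (n : ℕ) : LocalAt n (lastReset S C a n) := by
  induction n with
  | zero => intro _ _ _; rfl
  | succ n ih =>
    intro x y hxy
    rw [lastReset, lastReset, (ih.mono n.le_succ) x y hxy,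
      localAt_risk S C ((lastReset_le S C a n y).trans n.le_succ) x y hxy]

theorem localAt_numResets (n : ℕ) : LocalAt n (numResets S C a n) := by
  induction n with
  | zero => intro _ _ _; rfl
  | succ n ih =>
    intro x y hxy
    rw [numResets, numResets, (ih.mono n.le_succ) x y hxy,
      (localAt_lastReset S C a n).mono n.le_succ x y hxy,
      localAt_risk S C ((lastReset_le S C a n y).trans n.le_succ) x y hxy]

theorem monotone_numResets (ρ : ℕ → V) : Monotone fun n => numResets S C a n ρ :=
  monotone_nat_of_le_succ fun n => by
    rw [numResets]; split_ifs <;> omega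

/-- The current risk. -/
noncomputable def curRisk (n : ℕ) (ρ : ℕ → V) : ℝ≥0∞ := risk S C (lastReset S C a n ρ) n ρ

theorem localAt_curRisk (n : ℕ) : LocalAt n (curRisk S C a n) := by
  intro x y hxy
  rw [curRisk, curRisk, localAt_lastReset S C a n x y hxy,
    localAt_risk S C (lastReset_le S C a n y) x y hxy]

/-- The strategy that plays `S v` from `v` and is restarted as soon as the risk is too large. -/
noncomputable def restarting : M.Strategy :=
  .ofFun (fun n ρ => (S (ρ (lastReset S C a n ρ))).act (n - lastReset S C a n ρ)
    (hist _ (suffix ρ (lastReset S C a n ρ)))) fun n ρ hm => by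
      have := (S (ρ (lastReset S C a n ρ))).edge_act (n - lastReset S C a n ρ)
        (hist _ (suffix ρ (lastReset S C a n ρ)))
      simp only [hist, suffix, Nat.add_sub_cancel' (lastReset_le S C a n ρ)] at this
      exact this hm

theorem step_restarting (n : ℕ) (ρ : ℕ → V) :
    step (restarting S C a) n ρ = step (S (ρ (lastReset S C a n ρ))) (n - lastReset S C a n ρ)
      (suffix ρ (lastReset S C a n ρ)) := by
  refine step_congr ?_ fun _ => ?_
  · rw [suffix, Nat.add_sub_cancel' (lastReset_le S C a n ρ)]
  · refine Strategy.ofFun_act _ (fun x y hxy => ?_) ρ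
    have hr := localAt_lastReset S C a n x y hxy
    have hle := lastReset_le S C a n y
    have hh : hist (n - lastReset S C a n y) (suffix x (lastReset S C a n y)) =
        hist (n - lastReset S C a n y) (suffix y (lastReset S C a n y)) :=
      hist_congr fun i hi => hxy _ (by omega)
    rw [hr, hxy _ hle, hh]

variable {S C a}

/-- As long as no restart occurs the risk is a martingale; the reset time on the right is therefore
kept at its value at time `n`. -/
theorem curRisk_eq_tsum (hC : ∀ v, MeasurableSet (C v)) (n : ℕ) (ρ : ℕ → V) :
    curRisk S C a n ρ = ∑' u, step (restarting S C a) n ρ u *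
      risk S C (lastReset S C a n ρ) (n + 1) (snoc n ρ u) := by
  have hr := lastReset_le S C a n ρ
  rw [step_restarting, curRisk, risk, lawFrom_apply _ _ _ (hC _).compl]
  refine tsum_congr fun u => ?_
  rw [risk, snoc_of_le hr, suffix_snoc hr, show n + 1 - lastReset S C a n ρ =
    n - lastReset S C a n ρ + 1 by omega]

/-- The vertices from which `O` can be ensured with probability arbitrarily close to one. -/
def limitSureRegion (M : MDP V) (O : Set (ℕ → V)) : Set V :=
  {v | ∀ ε : ℝ≥0∞, 0 < ε → ∃ σ : M.Strategy, M.law σ v Oᶜ < ε}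

theorem law_after_compl_le {O : Set (ℕ → V)} (hO : ∀ ρ ∈ O, ∀ j, suffix ρ j ∈ O)
    (hm : MeasurableSet O) (σ : M.Strategy) (n : ℕ) (ρ : ℕ → V) :
    M.law (σ.after n ρ) (ρ n) Oᶜ ≤ lawFrom σ n ρ Oᶜ := by
  rw [← map_suffix_lawFrom, Measure.map_apply
    (f := fun x => suffix x n) (measurable_pi_lambda _ fun i => measurable_pi_apply _) hm.compl]
  exact measure_mono fun x hx hx' => hx (hO x hx' n)

/-- If `u` is reached with probability `p > 0`, failure below `p * ε` at `v` forces failure below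
`ε` after the move to `u`. -/
theorem mem_limitSureRegion_of_edge {O : Set (ℕ → V)} (hO : ∀ ρ ∈ O, ∀ j, suffix ρ j ∈ O)
    (hm : MeasurableSet O) {v u : V} (hv : v ∈ limitSureRegion M O) (hmain : v ∉ M.main)
    (he : M.Edge v u) : u ∈ limitSureRegion M O := by
  intro ε hε
  have hp : M.prob v hmain u ≠ 0 := by
    have : u ∈ (M.prob v hmain).support := by rw [M.support_prob]; exact he
    exact this
  obtain ⟨σ, hσ⟩ := hv (M.prob v hmain u * ε) (ENNReal.mul_pos hp hε.ne')
  refine ⟨σ.after 1 (snoc 0 (fun _ => v) u), ?_⟩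
  have h1 := law_after_compl_le hO hm σ 1 (snoc 0 (fun _ => v) u)
  rw [show snoc 0 (fun _ => v) u 1 = u from snoc_succ 0 _ u] at h1
  refine h1.trans_lt ?_
  rw [law_eq_lawFrom σ fun _ => v, lawFrom_apply _ _ _ hm.compl,
    step_not_main σ (ρ := fun _ => v) hmain] at hσ
  have h2 := (ENNReal.le_tsum u).trans_lt hσ
  exact lt_of_mul_lt_mul_left' h2

variable {O : Set (ℕ → V)}

theorem curRisk_zero (ρ : ℕ → V) : curRisk S C a 0 ρ = M.law (S (ρ 0)) (ρ 0) (C (ρ 0))ᶜ := by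
  rw [curRisk, lastReset, risk, law_eq_lawFrom]
  have h : suffix ρ 0 = ρ := funext fun i => congrArg ρ (Nat.zero_add i)
  rw [h]

theorem risk_self (n : ℕ) (ρ : ℕ → V) :
    risk S C n n ρ = M.law (S (ρ n)) (ρ n) (C (ρ n))ᶜ := by
  have := law_eq_lawFrom (S (ρ n)) (suffix ρ n)
  rw [show suffix ρ n 0 = ρ n from rfl] at this
  rw [risk, this, Nat.sub_self]

theorem mem_of_curRisk_lt (hO : ∀ ρ ∈ O, ∀ j, suffix ρ j ∈ O) (hm : MeasurableSet O)
    (hCO : ∀ v, C v ⊆ O) {δ : ℝ≥0∞} {W : Set V}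
    (hδ : ∀ v (σ : M.Strategy), M.law σ v Oᶜ < δ → v ∈ W) {n : ℕ} {ρ : ℕ → V}
    (h : curRisk S C a n ρ < δ) : ρ n ∈ W := by
  have hr := lastReset_le S C a n ρ
  have h1 := law_after_compl_le hO hm (S (ρ (lastReset S C a n ρ))) (n - lastReset S C a n ρ)
    (suffix ρ (lastReset S C a n ρ))
  rw [show suffix ρ (lastReset S C a n ρ) (n - lastReset S C a n ρ) = ρ n by
    rw [suffix, Nat.add_sub_cancel' hr]] at h1
  refine hδ _ _ (h1.trans_lt (lt_of_le_of_lt ?_ h))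
  exact measure_mono (Set.compl_subset_compl.2 (hCO _))

/-- A player move is deterministic and leaves the risk unchanged, so a restart can only follow a
probabilistic move. The vertex before it has risk below `4 * a`, hence lies in the limit-sure
region, and that region is closed under probabilistic moves. So `u` lies in it although the old risk
there is at least `4 * a`. -/
theorem curRisk_lt_of_step (hO : ∀ ρ ∈ O, ∀ j, suffix ρ j ∈ O)
    (hm : MeasurableSet O) (hC : ∀ v, MeasurableSet (C v)) (hCO : ∀ v, C v ⊆ O)
    (hδ : ∀ v (σ : M.Strategy), M.law σ v Oᶜ < 4 * a → v ∈ limitSureRegion M O)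
    (hS : ∀ v ∈ limitSureRegion M O, M.law (S v) v (C v)ᶜ ≤ a) {n : ℕ} {ρ : ℕ → V} {u : V}
    (h : curRisk S C a n ρ < 4 * a) (hu : step (restarting S C a) n ρ u ≠ 0)
    (hres : 4 * a ≤ risk S C (lastReset S C a n ρ) (n + 1) (snoc n ρ u)) :
    M.law (S u) u (C u)ᶜ ≤ a := by
  refine hS u ?_
  by_cases hmain : ρ n ∈ M.main
  · rw [curRisk_eq_tsum hC] at h
    rw [step_main _ hmain] at h hu
    have hu' : u = (restarting S C a).act n (hist n ρ) := by
      by_contra hne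
      exact hu (by simp [PMF.pure_apply, hne])
    have := (ENNReal.le_tsum u).trans_lt h
    rw [hu'] at this hres
    simp only [PMF.pure_apply, if_true, one_mul] at this
    exact absurd hres (not_le.2 this)
  · have := (follows_of_step_ne_zero hu).1
    rw [snoc_succ, snoc_of_le le_rfl] at this
    exact mem_limitSureRegion_of_edge hO hm (mem_of_curRisk_lt hO hm hCO hδ h) hmain this

theorem lastReset_snoc (n : ℕ) (ρ : ℕ → V) (u : V) :
    lastReset S C a n (snoc n ρ u) = lastReset S C a n ρ :=
  (localAt_lastReset S C a n).snoc ρ u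

theorem ae_mem_of_restarting (ha : 0 < a) (ha' : 4 * a ≤ 1) (hO : ∀ ρ ∈ O, ∀ j, suffix ρ j ∈ O)
    (hO' : ∀ ρ ∈ M.plays, ∀ j, suffix ρ j ∈ O → ρ ∈ O)
    (hm : MeasurableSet O) (hC : ∀ v, PrefixClosed (C v)) (hCO : ∀ v, C v ⊆ O)
    (hδ : ∀ v (σ : M.Strategy), M.law σ v Oᶜ < 4 * a → v ∈ limitSureRegion M O)
    (hS : ∀ v ∈ limitSureRegion M O, M.law (S v) v (C v)ᶜ ≤ a) {v : V}
    (hv : v ∈ limitSureRegion M O) : ∀ᵐ ρ ∂M.law (restarting S C a) v, ρ ∈ O := by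
  have hatop : a ≠ ∞ := by
    rintro rfl
    simp at ha'
  have halt : a < 4 * a := by
    have : (1 : ℝ≥0∞) * a < 4 * a := by
      gcongr
      norm_num
    rwa [one_mul] at this
  -- The supermartingale. A restart doubles the power but drops the risk from at least `4 * a` to at
  -- most `a`, and `2 * (a + 2 * a) = 4 * a + 2 * a`. The summand `2 * a` keeps `F` at least a fixed
  -- positive multiple of `2 ^ numResets`.
  set F : ℕ → (ℕ → V) → ℝ≥0∞ := fun n ρ =>
    2 ^ numResets S C a n ρ * (curRisk S C a n ρ + 2 * a) with hF
  have hFl : ∀ n, LocalAt n (F n) := fun n x y hxy => by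
    simp only [hF, localAt_numResets S C a n x y hxy, localAt_curRisk S C a n x y hxy]
  have hreset := fun n ρ u => curRisk_lt_of_step (S := S) (C := C) (a := a) hO hm
    (fun v => (hC v).measurableSet) hCO hδ hS (n := n) (ρ := ρ) (u := u)
  have hP : ∀ n ρ u, curRisk S C a n ρ < 4 * a → step (restarting S C a) n ρ u ≠ 0 →
      curRisk S C a (n + 1) (snoc n ρ u) < 4 * a := by
    intro n ρ u h hu
    rw [curRisk, lastReset, lastReset_snoc]
    split_ifs with hres
    · rw [risk_self, snoc_succ]
      exact (hreset n ρ u h hu hres).trans_lt halt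
    · exact not_le.1 hres
  have hle : ∀ n ρ, curRisk S C a n ρ < 4 * a →
      ∑' u, step (restarting S C a) n ρ u * F (n + 1) (snoc n ρ u) ≤ F n ρ := by
    intro n ρ h
    have h1 : ∀ u, step (restarting S C a) n ρ u * F (n + 1) (snoc n ρ u) ≤
        2 ^ numResets S C a n ρ * (step (restarting S C a) n ρ u *
          risk S C (lastReset S C a n ρ) (n + 1) (snoc n ρ u) +
          step (restarting S C a) n ρ u * (2 * a)) := by
      intro u
      by_cases hu : step (restarting S C a) n ρ u = 0
      · simp [hu]
      have h2 : F (n + 1) (snoc n ρ u) ≤ 2 ^ numResets S C a n ρ *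
          (risk S C (lastReset S C a n ρ) (n + 1) (snoc n ρ u) + 2 * a) := by
        simp only [hF]
        rw [curRisk, lastReset, numResets, lastReset_snoc, (localAt_numResets S C a n).snoc]
        split_ifs with hres
        · rw [pow_succ, mul_assoc, risk_self, snoc_succ]
          refine mul_le_mul_right ?_ (2 ^ numResets S C a n ρ)
          calc 2 * (M.law (S u) u (C u)ᶜ + 2 * a) ≤ 2 * (a + 2 * a) := by
                gcongr
                exact hreset n ρ u h hu hres
            _ = 4 * a + 2 * a := by ring
            _ ≤ _ := by gcongr
        · exact le_rfl
      exact (mul_le_mul_right h2 (step (restarting S C a) n ρ u)).trans_eq (by ring)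
    refine (ENNReal.tsum_le_tsum h1).trans ?_
    rw [ENNReal.tsum_mul_left, ENNReal.tsum_add, ENNReal.tsum_mul_right, tsum_step, one_mul,
      ← curRisk_eq_tsum fun v => (hC v).measurableSet]
  have h0 : curRisk S C a 0 (fun _ => v) ≤ a := by
    rw [curRisk_zero]
    exact hS v hv
  have hbound : ∀ n, ∫⁻ x, 2 ^ numResets S C a n x * (2 * a) ∂M.law (restarting S C a) v ≤
      3 * a := by
    intro n
    have h2 := lintegral_lawFrom_le hFl hP hle n 0 (fun _ => v) (h0.trans_lt halt)
    rw [← law_eq_lawFrom, Nat.zero_add] at h2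
    refine (lintegral_mono fun x => ?_).trans (h2.trans ?_)
    · simp only [hF]
      gcongr
      exact le_add_self
    · simp only [hF, numResets, pow_zero, one_mul]
      calc _ ≤ a + 2 * a := by gcongr
        _ = 3 * a := by ring
  have hmeas : ∀ n, Measurable fun x : ℕ → V => (2 : ℝ≥0∞) ^ numResets S C a n x * (2 * a) :=
    fun n => LocalAt.measurable (n := n) fun x y hxy => by
      rw [localAt_numResets S C a n x y hxy]
  -- Monotone convergence turns the uniform bound `3 * a` into almost sure finiteness of the
  -- supremum, hence of the number of restarts.
  have hfin : ∀ᵐ x ∂M.law (restarting S C a) v,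
      ⨆ n, (2 : ℝ≥0∞) ^ numResets S C a n x * (2 * a) < ∞ := by
    refine ae_lt_top (Measurable.iSup hmeas) (ne_top_of_le_ne_top (b := 3 * a)
      (ENNReal.mul_ne_top (by norm_num) hatop) ?_)
    rw [lintegral_iSup hmeas]
    · exact iSup_le hbound
    · intro m n hmn x
      have := monotone_numResets S C a x hmn
      exact mul_le_mul_left (pow_le_pow_right₀ (by norm_num) this) _
  filter_upwards [hfin, ae_law_outcomes (restarting S C a) v] with ρ hρ hout
  obtain ⟨K, hK⟩ : ∃ K, ∀ n, numResets S C a n ρ ≤ K := by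
    by_contra! hcon
    refine hρ.ne (ENNReal.eq_top_of_forall_nnreal_le fun r => ?_)
    obtain ⟨K, hK⟩ := ENNReal.exists_nat_mul_gt (a := 2 * a) (b := r)
      (mul_ne_zero two_ne_zero ha.ne') ENNReal.coe_ne_top
    obtain ⟨n, hn⟩ := hcon K
    refine le_trans ?_ (le_iSup _ n)
    refine hK.le.trans ?_
    gcongr
    calc (K : ℝ≥0∞) ≤ ((2 ^ K : ℕ) : ℝ≥0∞) := by exact_mod_cast Nat.lt_two_pow_self.le
      _ = 2 ^ K := by push_cast; rfl
      _ ≤ _ := pow_le_pow_right₀ (by norm_num) hn.le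
  obtain ⟨N, hN⟩ : ∃ N, ∀ n ≥ N, numResets S C a n ρ = numResets S C a N ρ := by
    obtain ⟨N, hN⟩ := WellFoundedGT.monotone_chain_condition
      (⟨fun n => (⟨numResets S C a n ρ, Nat.lt_succ_of_le (hK n)⟩ : Fin (K + 1)),
        fun m n h => monotone_numResets S C a ρ h⟩ : ℕ →o Fin (K + 1))
    exact ⟨N, fun n hn => (congrArg Fin.val (hN n hn)).symm⟩
  have hno : ∀ n ≥ N, ¬ 4 * a ≤ risk S C (lastReset S C a n ρ) (n + 1) ρ := by
    intro n hn hres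
    have h1 := hN (n + 1) (by omega)
    rw [numResets, if_pos hres, hN n hn] at h1
    omega
  have hconst : ∀ n ≥ N, lastReset S C a n ρ = lastReset S C a N ρ := by
    intro n hn
    induction n, hn using Nat.le_induction with
    | base => rfl
    | succ n hn ih => rw [lastReset, if_neg (hno n hn), ih]
  set r := lastReset S C a N ρ with hr
  have hrN : r ≤ N := lastReset_le S C a N ρ
  refine hO' ρ hout.1 r (hCO (ρ r) (hC (ρ r) _ fun m => ?_))
  refine antitone_prefixes (C (ρ r)) (show m ≤ N + m + 1 - r by omega) ?_
  -- After the last restart the risk is below 1, whereas a history outside `prefixes` would miss the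
  -- closed target with probability 1.
  have h1 := (not_le.1 (hno (N + m) (by omega))).trans_le ha'
  rw [hconst _ (by omega), risk] at h1
  by_contra hcon
  have h2 := lawFrom_apply_of_localAt (S (ρ r)) (suffix ρ r)
    (localAt_prefixes (C (ρ r)) (N + m + 1 - r))
  rw [if_neg hcon] at h2
  have h3 := measure_mono_null (subset_prefixes (C (ρ r)) (N + m + 1 - r)) h2
  rw [(prob_compl_eq_one_iff (hC (ρ r)).measurableSet).2 h3] at h1
  exact lt_irrefl _ h1

/-- For a prefix-independent countable union of closed sets, a vertex that wins limit-surely wins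
almost surely. -/
theorem exists_law_eq_one_of_limitSure {B : ℕ → Set (ℕ → V)} (hB : Monotone B)
    (hBc : ∀ k, PrefixClosed (B k))
    (hO : ∀ ρ ∈ ⋃ k, B k, ∀ j, suffix ρ j ∈ ⋃ k, B k)
    (hO' : ∀ ρ ∈ M.plays, ∀ j, suffix ρ j ∈ ⋃ k, B k → ρ ∈ ⋃ k, B k) {v : V}
    (hv : v ∈ limitSureRegion M (⋃ k, B k)) : ∃ σ : M.Strategy, M.law σ v (⋃ k, B k) = 1 := by
  set O := ⋃ k, B k with hOdef
  have hm : MeasurableSet O := MeasurableSet.iUnion fun k => (hBc k).measurableSet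
  -- Each vertex outside the region has a positive lower bound on its failure probability; vertices
  -- inside get the dummy value 1. Finiteness of `V` gives a least bound, and `a` is a quarter of
  -- it, capped at 1.
  obtain ⟨a, ha, ha', hδ⟩ : ∃ a : ℝ≥0∞, 0 < a ∧ 4 * a ≤ 1 ∧
      ∀ v (σ : M.Strategy), M.law σ v Oᶜ < 4 * a → v ∈ limitSureRegion M O := by
    have : ∀ w : V, ∃ δ : ℝ≥0∞, 0 < δ ∧
        ∀ σ : M.Strategy, M.law σ w Oᶜ < δ → w ∈ limitSureRegion M O := by
      intro w
      by_cases hw : w ∈ limitSureRegion M O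
      · exact ⟨1, one_pos, fun _ _ => hw⟩
      · have hw' := hw
        simp only [limitSureRegion, Set.mem_ofPred_eq, not_forall, not_exists] at hw'
        obtain ⟨ε, hε, h⟩ := hw'
        exact ⟨ε, hε, fun σ hσ => absurd hσ (h σ)⟩
    choose δ hδ0 hδ using this
    have : Nonempty V := ⟨v⟩
    obtain ⟨w₀, hw₀⟩ := Finite.exists_min δ
    have h4 : 4 * (min (δ w₀) 1 / 4) = min (δ w₀) 1 :=
      ENNReal.mul_div_cancel (by norm_num) (by norm_num)
    refine ⟨min (δ w₀) 1 / 4, ENNReal.div_pos (lt_min (hδ0 w₀) one_pos).ne' (by norm_num),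
      h4.trans_le (min_le_right _ _), fun w σ hσ => ?_⟩
    rw [h4] at hσ
    exact hδ w σ (hσ.trans_le ((min_le_left _ _).trans (hw₀ w)))
  have : ∀ w : V, ∃ (σ : M.Strategy) (k : ℕ), w ∈ limitSureRegion M O →
      M.law σ w (B k)ᶜ ≤ a := by
    intro w
    by_cases hw : w ∈ limitSureRegion M O
    · obtain ⟨σ, hσ⟩ := hw a ha
      -- Continuity from above replaces the union by one closed set `B k` that is still missed with
      -- probability below `a`.
      have hlim := tendsto_measure_iInter_atTop (μ := M.law σ w) (s := fun k => (B k)ᶜ)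
        (fun k => (hBc k).measurableSet.compl.nullMeasurableSet)
        (fun i j h => Set.compl_subset_compl.2 (hB h)) ⟨0, measure_ne_top _ _⟩
      rw [← Set.compl_iUnion, ← hOdef] at hlim
      obtain ⟨k, hk⟩ := (hlim.eventually (gt_mem_nhds hσ)).exists
      exact ⟨σ, k, fun _ => hk.le⟩
    · obtain ⟨σ⟩ := exists_strategy M
      exact ⟨σ, 0, fun h => absurd h hw⟩
  choose S k hS using this
  refine ⟨restarting S (fun w => B (k w)) a, ?_⟩
  exact (mem_ae_iff_prob_eq_one hm).1 (ae_mem_of_restarting ha ha' hO hO' hm (fun w => hBc (k w))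
    (fun w => Set.subset_iUnion B (k w)) hδ hS hv)

end Resets

/-! ### Window objectives as countable unions of closed sets -/

section Windows

variable {V : Type*} (M : MDP V)

/-- The plays in which every window opened at time `k` or later closes within `ℓ` steps. -/
def FWMPFrom (ℓ : ℕ) (thr : ℚ) (k : ℕ) : Set (ℕ → V) :=
  {ρ | ρ ∈ M.plays ∧ ∀ i ≥ k, suffix ρ i ∈ M.GW ℓ thr}

theorem iUnion_FWMPFrom (ℓ : ℕ) (thr : ℚ) : ⋃ k, M.FWMPFrom ℓ thr k = M.FWMP ℓ thr := by
  ext ρ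
  rw [Set.mem_iUnion]
  constructor
  · rintro ⟨k, hp, h⟩
    refine ⟨hp, k, suffix_mem_plays hp k, fun i => ?_⟩
    rw [suffix_suffix]
    exact h _ (Nat.le_add_right k i)
  · rintro ⟨hp, k, -, h⟩
    refine ⟨k, hp, fun i hi => ?_⟩
    have := h (i - k)
    rwa [suffix_suffix, Nat.add_sub_cancel' hi] at this

theorem monotone_FWMPFrom (ℓ : ℕ) (thr : ℚ) : Monotone (M.FWMPFrom ℓ thr) :=
  fun _ _ h _ hρ => ⟨hρ.1, fun i hi => hρ.2 i (h.trans hi)⟩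

/-- Whether the window opened at `i` closes in time is decided by the history up to `i + ℓ`. -/
theorem prefixClosed_FWMPFrom (ℓ : ℕ) (thr : ℚ) (k : ℕ) : PrefixClosed (M.FWMPFrom ℓ thr k) := by
  intro ρ hρ
  have hp : ρ ∈ M.plays := fun i => by
    obtain ⟨x, hx, h⟩ := hρ (i + 1)
    rw [← h i i.le_succ, ← h (i + 1) le_rfl]
    exact hx.1 i
  refine ⟨hp, fun i hi => ⟨suffix_mem_plays hp i, ?_⟩⟩
  obtain ⟨x, hx, h⟩ := hρ (i + ℓ)
  obtain ⟨-, j, hj1, hjl, hj⟩ := hx.2 i hi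
  refine ⟨j, hj1, hjl, hj.trans_eq ?_⟩
  congr 1
  refine Finset.sum_congr rfl fun m hm => ?_
  have := Finset.mem_range.1 hm
  simp only [suffix]
  rw [h _ (by omega), h _ (by omega)]

theorem FWMP_of_suffix {ℓ : ℕ} {thr : ℚ} {ρ : ℕ → V} (hρ : ρ ∈ M.plays) (j : ℕ)
    (h : suffix ρ j ∈ M.FWMP ℓ thr) : ρ ∈ M.FWMP ℓ thr := by
  obtain ⟨-, k, hk⟩ := h
  exact ⟨hρ, j + k, by rwa [suffix_suffix] at hk⟩

theorem FWMP_antitone {ℓ : ℕ} {α β : ℚ} (h : α ≤ β) : M.FWMP ℓ β ⊆ M.FWMP ℓ α := by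
  rintro ρ ⟨hp, k, hk, hw⟩
  refine ⟨hp, k, hk, fun i => ?_⟩
  obtain ⟨hi, j, h1, hl, hj⟩ := hw i
  exact ⟨hi, j, h1, hl, h.trans hj⟩

theorem measurableSet_FWMP [Finite V] [MeasurableSpace V] [DiscreteMeasurableSpace V]
    (ℓ : ℕ) (thr : ℚ) : MeasurableSet (M.FWMP ℓ thr) := by
  rw [← iUnion_FWMPFrom]
  exact MeasurableSet.iUnion fun k => (M.prefixClosed_FWMPFrom ℓ thr k).measurableSet

theorem exists_law_FWMP_eq_one [Finite V] [MeasurableSpace V] [DiscreteMeasurableSpace V]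
    {ℓ : ℕ} {thr : ℚ} {v : V} (hv : v ∈ limitSureRegion M (M.FWMP ℓ thr)) :
    ∃ σ : M.Strategy, M.law σ v (M.FWMP ℓ thr) = 1 := by
  have h := M.iUnion_FWMPFrom ℓ thr
  rw [← h] at hv ⊢
  refine exists_law_eq_one_of_limitSure (M.monotone_FWMPFrom ℓ thr) (M.prefixClosed_FWMPFrom ℓ thr)
    ?_ ?_ hv
  · rw [h]
    exact fun ρ hρ j => suffix_mem_FWMP hρ j
  · rw [h]
    exact fun ρ hρ j => M.FWMP_of_suffix hρ j

end Windows

/-! ### Switching to a sure strategy on leaving a closed set -/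

section Fallback

variable {V : Type*} {M : MDP V}

/-- The first time at which `ρ` can no longer be continued to a path in `C`. -/
noncomputable def exitTime (C : Set (ℕ → V)) (ρ : ℕ → V) : ℕ := sInf {j | ρ ∉ prefixes C j}

theorem exitTime_le {C : Set (ℕ → V)} {ρ : ℕ → V} {n : ℕ} (h : ρ ∉ prefixes C n) :
    exitTime C ρ ≤ n := Nat.sInf_le h

theorem notMem_prefixes_exitTime {C : Set (ℕ → V)} {ρ : ℕ → V} {n : ℕ} (h : ρ ∉ prefixes C n) :
    ρ ∉ prefixes C (exitTime C ρ) := Nat.sInf_mem (s := {j | ρ ∉ prefixes C j}) ⟨n, h⟩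

theorem mem_prefixes_of_lt_exitTime {C : Set (ℕ → V)} {ρ : ℕ → V} {n : ℕ}
    (h : n < exitTime C ρ) : ρ ∈ prefixes C n := by
  by_contra hcon
  exact absurd (exitTime_le hcon) (not_le.2 h)

theorem exitTime_congr {C : Set (ℕ → V)} {n : ℕ} {x y : ℕ → V} (hxy : ∀ i ≤ n, x i = y i)
    (h : x ∉ prefixes C n) : exitTime C x = exitTime C y := by
  have hl : ∀ j ≤ n, (x ∈ prefixes C j) = (y ∈ prefixes C j) := fun j hj =>
    localAt_prefixes C j x y fun i hi => hxy i (hi.trans hj)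
  have hy : y ∉ prefixes C n := by rwa [← hl n le_rfl]
  refine le_antisymm (exitTime_le ?_) (exitTime_le ?_)
  · rw [hl _ (exitTime_le hy)]
    exact notMem_prefixes_exitTime hy
  · rw [← hl _ (exitTime_le h)]
    exact notMem_prefixes_exitTime h

open Classical in
/-- The strategy that plays `σ` as long as a path in `C` is possible, and from then on the strategy
that `S` assigns to the current vertex. -/
noncomputable def fallback (σ : M.Strategy) (S : V → M.Strategy) (C : Set (ℕ → V)) : M.Strategy :=
  .ofFun (fun n ρ => if ρ ∈ prefixes C n then σ.act n (hist n ρ)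
      else (S (ρ (exitTime C ρ))).act (n - exitTime C ρ) (hist _ (suffix ρ (exitTime C ρ))))
    fun n ρ hm => by
      split_ifs with h
      · exact σ.edge_act n (hist n ρ) hm
      · have := (S (ρ (exitTime C ρ))).edge_act (n - exitTime C ρ)
          (hist _ (suffix ρ (exitTime C ρ)))
        simp only [hist, suffix, Nat.add_sub_cancel' (exitTime_le h)] at this
        exact this hm

variable (σ : M.Strategy) (S : V → M.Strategy) {C : Set (ℕ → V)}

open Classical in
theorem fallback_act (n : ℕ) (ρ : ℕ → V) :
    (fallback σ S C).act n (hist n ρ) = if ρ ∈ prefixes C n then σ.act n (hist n ρ)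
      else (S (ρ (exitTime C ρ))).act (n - exitTime C ρ) (hist _ (suffix ρ (exitTime C ρ))) := by
  refine Strategy.ofFun_act _ (fun x y hxy => ?_) ρ
  have hl : (x ∈ prefixes C n) = (y ∈ prefixes C n) := localAt_prefixes C n x y hxy
  by_cases h : x ∈ prefixes C n
  · rw [if_pos h, if_pos (hl ▸ h), hist_congr hxy]
  · have hy : y ∉ prefixes C n := hl ▸ h
    have hle := exitTime_le hy
    have hh : hist (n - exitTime C y) (suffix x (exitTime C y)) =
        hist (n - exitTime C y) (suffix y (exitTime C y)) :=
      hist_congr fun i hi => hxy _ (by omega)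
    rw [if_neg h, if_neg hy, exitTime_congr hxy h, hxy _ hle, hh]

/-- A play that never exits lies in `C` by closedness. Otherwise it followed `σ` up to the exit, so
the exit vertex is in `W`, and its tail is an outcome of the sure strategy chosen there. -/
theorem outcomes_fallback_subset {A : Set (ℕ → V)} {W : Set V} {v : V} (hC : PrefixClosed C)
    (hCA : C ⊆ A) (hA : ∀ ρ ∈ M.plays, ∀ j, suffix ρ j ∈ A → ρ ∈ A)
    (hW : ∀ n (ρ : ℕ → V), ρ 0 = v → (∀ i < n, Follows σ i ρ) → ρ n ∈ W)
    (hS : ∀ w ∈ W, M.outcomes (S w) w ⊆ A) : M.outcomes (fallback σ S C) v ⊆ A := by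
  intro x hx
  obtain ⟨h0, hf⟩ := mem_outcomes_iff.1 hx
  by_cases hall : ∀ n, x ∈ prefixes C n
  · exact hCA (hC x hall)
  push Not at hall
  obtain ⟨n, hn⟩ := hall
  have hmem : x (exitTime C x) ∈ W := hW _ x h0 fun i hi => by
    refine ⟨(hf i).1, fun hm => ?_⟩
    rw [(hf i).2 hm, fallback_act, if_pos (mem_prefixes_of_lt_exitTime hi)]
  refine hA x hx.1 (exitTime C x) (hS _ hmem (mem_outcomes_iff.2 ⟨rfl, fun m => ?_⟩))
  have hm := hf (exitTime C x + m)
  refine ⟨hm.1, fun hmain => ?_⟩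
  have h1 := hm.2 hmain
  rw [fallback_act, if_neg fun h => notMem_prefixes_exitTime hn
    (antitone_prefixes C (Nat.le_add_right _ m) h)] at h1
  rwa [Nat.add_sub_cancel_left] at h1

variable [Finite V] [MeasurableSpace V] [DiscreteMeasurableSpace V]

/-- The two strategies move alike while the history is in `prefixes`; once it is not, the left side
is 0. -/
theorem lawFrom_prefixes_le_fallback (k n : ℕ) (ρ : ℕ → V) :
    lawFrom σ n ρ (prefixes C (n + k)) ≤ lawFrom (fallback σ S C) n ρ (prefixes C (n + k)) := by
  classical
  induction k generalizing n ρ with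
  | zero =>
    rw [Nat.add_zero, lawFrom_apply_of_localAt _ _ (localAt_prefixes C n),
      lawFrom_apply_of_localAt _ _ (localAt_prefixes C n)]
  | succ k ih =>
    by_cases h : ρ ∈ prefixes C n
    · rw [lawFrom_apply _ _ _ (localAt_prefixes C _).measurableSet,
        lawFrom_apply _ _ _ (localAt_prefixes C _).measurableSet,
        step_congr (σ := fallback σ S C) (σ' := σ) (ρ' := ρ) rfl fun _ => by
          rw [fallback_act, if_pos h]]
      refine ENNReal.tsum_le_tsum fun u => mul_le_mul_right ?_ _
      have := ih (n + 1) (snoc n ρ u)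
      rwa [show n + 1 + k = n + (k + 1) by omega] at this
    · have h1 := measure_mono (μ := lawFrom σ n ρ) (antitone_prefixes C (Nat.le_add_right n (k + 1)))
      rw [lawFrom_apply_of_localAt _ _ (localAt_prefixes C n), if_neg h] at h1
      exact h1.trans zero_le

theorem law_le_law_fallback (hC : PrefixClosed C) (v : V) :
    M.law σ v C ≤ M.law (fallback σ S C) v C := by
  have hlim := tendsto_measure_iInter_atTop (μ := M.law (fallback σ S C) v) (s := prefixes C)
    (fun n => (localAt_prefixes C n).measurableSet.nullMeasurableSet) (antitone_prefixes C)
    ⟨0, measure_ne_top _ _⟩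
  rw [hC.iInter_prefixes] at hlim
  refine ge_of_tendsto' hlim fun n => (measure_mono (subset_prefixes C n)).trans ?_
  have := lawFrom_prefixes_le_fallback σ S (C := C) n 0 (fun _ => v)
  rwa [Nat.zero_add, ← law_eq_lawFrom, ← law_eq_lawFrom] at this

end Fallback

/-! ### The two inclusions -/

section Main

variable {V : Type*} {M : MDP V}

theorem mem_of_follows_ofSub {W : Set V} {hW : M.InducesSubMDP W} (σ : (M.subMDP W hW).Strategy)
    (v : W) {n : ℕ} {ρ : ℕ → V} (h0 : ρ 0 = v) (hρ : ∀ i < n, Follows (σ.ofSub v) i ρ) :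
    ρ n ∈ W := by
  suffices ∀ m ≤ n, ∀ i ≤ m, ρ i ∈ W from this n le_rfl n le_rfl
  intro m
  induction m with
  | zero =>
    intro _ i hi
    rw [Nat.le_zero.1 hi, h0]
    exact v.2
  | succ m ih =>
    intro hm i hi
    have ih' := ih (by omega)
    rcases Nat.le_succ_iff.1 hi with hi | rfl
    · exact ih' i hi
    · obtain ⟨he, ha⟩ := hρ m hm
      by_cases hmain : ρ m ∈ M.main
      · rw [ha hmain]
        exact σ.ofSub_act_mem v ih'
      · exact hW.2 _ (ih' m le_rfl) hmain _ he

variable [Finite V] [MeasurableSpace V] [DiscreteMeasurableSpace V]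

theorem law_preimage_val {W : Set V} {hW : M.InducesSubMDP W} {σ' : (M.subMDP W hW).Strategy}
    {v : W} {σ : M.Strategy}
    (h : ((M.subMDP W hW).law σ' v).map (fun ρ i => (ρ i : V)) = M.law σ v) {A : Set (ℕ → V)}
    (hA : MeasurableSet A) :
    (M.subMDP W hW).law σ' v ((fun ρ i => (ρ i : V)) ⁻¹' A) = M.law σ v A := by
  rw [← h, Measure.map_apply (f := fun (ρ : ℕ → W) i => (ρ i : V)) (measurable_pi_lambda _ fun i =>
    measurable_subtype_coe.comp (measurable_pi_apply i)) hA]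

theorem law_eq_one_of_outcomes_subset {σ : M.Strategy} {v : V} {O : Set (ℕ → V)}
    (hO : MeasurableSet O) (h : M.outcomes σ v ⊆ O) : M.law σ v O = 1 :=
  (mem_ae_iff_prob_eq_one hO).1 ((ae_law_outcomes σ v).mono fun _ hρ => h hρ)

/-- A strategy of the subMDP induced by the winning region for sure-`FWMP ℓ α` that almost surely
ensures `FWMP ℓ β` yields strategies that ensure `FWMP ℓ α` surely and `FWMP ℓ β` limit-surely. -/
theorem slsFWMP_subset (ℓ : ℕ) (α β : ℚ) :
    M.slsFWMP ℓ α β ⊆ M.sureLimitSureRegion (M.FWMP ℓ α) (M.FWMP ℓ β) := by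
  rintro _ ⟨w, ⟨σ', hσ'⟩, rfl⟩ ε hε _
  have hε' : ENNReal.ofReal (1 - ε) < 1 := by
    rw [← ENNReal.ofReal_one]
    exact (ENNReal.ofReal_lt_ofReal_iff one_pos).2 (by linarith)
  -- Staying in the closed set for `β` forever must also ensure `α`, which needs `α ≤ β`.
  rcases le_or_gt α β with h | h
  · have hlaw : M.law (σ'.ofSub w) w (M.FWMP ℓ β) = 1 := by
      rw [← law_preimage_val (map_val_law_ofSub σ' w) (M.measurableSet_FWMP ℓ β)]
      exact hσ'
    have hlim := tendsto_measure_iUnion_atTop (μ := M.law (σ'.ofSub w) w)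
      (M.monotone_FWMPFrom ℓ β)
    rw [iUnion_FWMPFrom, hlaw] at hlim
    obtain ⟨k, hk⟩ := (hlim.eventually (lt_mem_nhds hε')).exists
    have hsub : M.FWMPFrom ℓ β k ⊆ M.FWMP ℓ β := by
      rw [← iUnion_FWMPFrom]
      exact Set.subset_iUnion _ k
    obtain ⟨σ₀⟩ := exists_strategy M
    have : ∀ u : V, ∃ τ : M.Strategy, u ∈ M.sureRegion (M.FWMP ℓ α) →
        M.outcomes τ u ⊆ M.FWMP ℓ α := by
      intro u
      by_cases hu : u ∈ M.sureRegion (M.FWMP ℓ α)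
      · exact hu.imp fun τ hτ _ => hτ
      · exact ⟨σ₀, fun hu' => absurd hu' hu⟩
    choose S hS using this
    refine ⟨fallback (σ'.ofSub w) S (M.FWMPFrom ℓ β k), ?_, ?_⟩
    · exact outcomes_fallback_subset _ S (M.prefixClosed_FWMPFrom ℓ β k)
        (hsub.trans (M.FWMP_antitone h)) (fun ρ hρ j => M.FWMP_of_suffix hρ j)
        (fun n ρ => mem_of_follows_ofSub σ' w) hS
    · exact hk.le.trans ((law_le_law_fallback _ S (M.prefixClosed_FWMPFrom ℓ β k) w).trans
        (measure_mono hsub))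
  · obtain ⟨σ, hσ⟩ := w.2
    refine ⟨σ, hσ, ?_⟩
    rw [law_eq_one_of_outcomes_subset (M.measurableSet_FWMP ℓ β) (hσ.trans (M.FWMP_antitone h.le))]
    exact hε'.le

theorem sureLimitSureRegion_subset (ℓ : ℕ) (α β : ℚ) :
    M.sureLimitSureRegion (M.FWMP ℓ α) (M.FWMP ℓ β) ⊆ M.slsFWMP ℓ α β := by
  intro v hv
  have hvW : v ∈ M.sureRegion (M.FWMP ℓ α) := by
    obtain ⟨σ, hσ, -⟩ := hv (1 / 2) (by norm_num) (by norm_num)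
    exact ⟨σ, hσ⟩
  refine ⟨⟨v, hvW⟩, exists_law_FWMP_eq_one _ fun ε hε => ?_, rfl⟩
  -- Here `ε` may be infinite or at least 1, while the hypothesis accepts only reals below 1; hence
  -- a finite `δ < ε`, capped at `1 / 2`.
  obtain ⟨δ, hδ0, hδ⟩ := ENNReal.lt_iff_exists_nnreal_btwn.1 hε
  have hδ0' : (0 : ℝ) < δ := by exact_mod_cast hδ0
  obtain ⟨σ, hσ, hlaw⟩ := hv (min δ (1 / 2)) (lt_min hδ0' (by norm_num))
    ((min_le_right _ _).trans_lt (by norm_num))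
  refine ⟨σ.toSub _, ?_⟩
  -- Every vertex reachable under a surely winning strategy is again surely winning, so restricting
  -- to the subMDP preserves the law.
  refine (law_preimage_val (map_val_law_toSub (v := ⟨v, hvW⟩) fun n ρ h0 hρ =>
    mem_sureRegion_of_follows (fun ρ hρ j => suffix_mem_FWMP hρ j) (h0 ▸ hσ) hρ)
    (M.measurableSet_FWMP ℓ β).compl).trans_lt ?_
  rw [prob_compl_eq_one_sub (M.measurableSet_FWMP ℓ β)]
  refine lt_of_le_of_lt ?_ hδ
  rw [tsub_le_iff_left]
  refine le_trans ?_ (add_le_add_left hlaw _)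
  rw [← ENNReal.ofReal_coe_nnreal, ← ENNReal.ofReal_add (by
    have := min_le_right (δ : ℝ) (1 / 2)
    linarith) hδ0'.le, ← ENNReal.ofReal_one]
  refine ENNReal.ofReal_le_ofReal ?_
  have := min_le_left (δ : ℝ) (1 / 2)
  linarith

end Main

end MDP

theorem mainTheorem4 {V : Type*} [Finite V] [MeasurableSpace V] [DiscreteMeasurableSpace V]
    (M : MDP V) (ℓ : ℕ) (hℓ : 1 ≤ ℓ) (α β : ℚ) :
    M.slsFWMP ℓ α β = M.sureLimitSureRegion (M.FWMP ℓ α) (M.FWMP ℓ β) :=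
  (MDP.slsFWMP_subset ℓ α β).antisymm (MDP.sureLimitSureRegion_subset ℓ α β)
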